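/- Let $k\ge 3$. A $k$-graph $H$ is a finite $k$-uniform hypergraph with vertex set $V(H)$ and edge set $E(H)\subseteq\binom{V(H)}{k}$; let $v(H)=|V(H)|$. For $1\le s\le k-1$, its minimum $s$-degree $\delta_s(H)$ is the minimum, over all $s$-element sets $S\subseteq V(H)$, of the number of edges containing $S$. For $p\in[0,1]$ and $\mu>0$, an $n$-vertex $k$-graph $H$ is $(p,\mu,\cdot)$-dense if for all $X_1,\dots,X_k\subseteq V(H)$ the number of tuples $(x_1,\dots,x_k)\in X_1\times\cdots\times X_k$ with $\{x_1,\dots,x_k\}\in E(H)$ is at least $p|X_1|\cdots|X_k|-\mu n^k$. An $F$-factor in $H$ is a set of pairwise vertex-disjoint copies of $F$ in $H$ (not necessarily induced) that together cover $V(H)$. Let $\mathbf{FACTOR}_k^{\cdot,s}$ be the class of $k$-graphs $F$ such that for all $0<p,\alpha<1$ there are $n_0\in\mathbb N$ and $\mu>0$ such that every $(p,\mu,\cdot)$-dense $k$-graph $H$ on $n\ge n_0$ vertices with $\delta_s(H)\ge\alpha n^{k-s}$ and $v(F)\mid n$ has an $F$-factor. A $k$-partite realisation of a $k$-graph $F$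 is a partition of $V(F)$ into nonempty classes $V_1,\dots,V_k$ such that $|e\cap V_i|=1$ for all $e\in E(F)$ and all $i$; $F$ is $k$-partite if it has one, and complete $k$-partite if for some $k$-partite realisation every set with exactly one vertex in each class is an edge. Let $\mathcal S(F)$ be the set of all the numbers $|V_1|,\dots,|V_k|$ over all $k$-partite realisations of $F$, and $\gcd(\mathcal S(F))$ its greatest common divisor. **Theorem.** Let $F$ be a $k$-partite $k$-graph. If $\gcd(\mathcal S(F))=1$, then $F\in\mathbf{FACTOR}_k^{\cdot,k-1}$. Moreover, if $F$ is a complete $k$-partite $k$-graph, then $F\in\mathbf{FACTOR}_k^{\cdot,k-1}$ if and only if $\gcd(\mathcal S(F))=1$. -/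

import Mathlib

/-- A `k`-graph (`k`-uniform hypergraph) with vertex set `V`: a family of `k`-element subsets
of `V`, the edges. -/
structure KGraph (k : ℕ) (V : Type*) where
  edges : Finset (Finset V)
  uniform : ∀ e ∈ edges, e.card = k

namespace KGraph

universe u

variable {k : ℕ} {V W : Type*} [Fintype V] [DecidableEq V] [Fintype W] [DecidableEq W]

/-- The degree of a vertex set `S`: the number of edges that contain `S`. -/
def deg (H : KGraph k V) (S : Finset V) : ℕ :=
  (H.edges.filter fun e => S ⊆ e).card

/-- The minimum `s`-degree: the least degree of an `s`-element set of vertices.  (It is `0` by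
convention if there are fewer than `s` vertices.) -/
noncomputable def minDegree (H : KGraph k V) (s : ℕ) : ℕ :=
  sInf {d : ℕ | ∃ S : Finset V, S.card = s ∧ d = H.deg S}

/-- The number of ordered tuples `(x_1, …, x_k) ∈ X_1 × ⋯ × X_k` such that `{x_1, …, x_k}` is an
edge. -/
def edgeTuples (H : KGraph k V) (X : Fin k → Finset V) : ℕ :=
  ((Fintype.piFinset X).filter fun x => Finset.univ.image x ∈ H.edges).card

/-- `H` is dense with parameters `p, μ` in the weakest (vertex-set) sense: every `k` vertex sets
`X_1, …, X_k` span at least `p |X_1| ⋯ |X_k| - μ n ^ k` edge tuples, `n` being the number of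
vertices of `H`. -/
def IsDense (H : KGraph k V) (p μ : ℝ) : Prop :=
  ∀ X : Fin k → Finset V,
    p * ∏ i, ((X i).card : ℝ) - μ * (Fintype.card V : ℝ) ^ k ≤ (H.edgeTuples X : ℝ)

/-- An injection of the vertices of `F` into those of `H` that maps edges to edges.  Its image is
a copy of `F` in `H`, and every copy of `F` in `H` is such an image. -/
structure Copy (F : KGraph k V) (H : KGraph k W) where
  toEmbedding : V ↪ W
  map_edges : ∀ e ∈ F.edges, e.map toEmbedding ∈ H.edges

/-- The set of vertices of `H` covered by a copy of `F`. -/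
def Copy.verts {F : KGraph k V} {H : KGraph k W} (c : Copy F H) : Set W :=
  Set.range c.toEmbedding

/-- `H` has an `F`-factor: a set of pairwise vertex-disjoint copies of `F` that together cover all
vertices of `H`. -/
def HasFactor (F : KGraph k V) (H : KGraph k W) : Prop :=
  ∃ T : Set (Copy F H), T.PairwiseDisjoint Copy.verts ∧ ⋃ c ∈ T, c.verts = Set.univ

/-- Membership of the `k`-graph `F` in the class `FACTOR_k^{·,s}`: for all `0 < p, α < 1` there are
`n₀` and `μ > 0` such that every `(p, μ)`-dense `k`-graph `H` on `n ≥ n₀` vertices with minimum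
`s`-degree at least `α n ^ (k - s)` and `v(F) ∣ n` has an `F`-factor. -/
def InFACTOR {V : Type u} [Fintype V] [DecidableEq V] (F : KGraph k V) (s : ℕ) : Prop :=
  ∀ p α : ℝ, 0 < p → p < 1 → 0 < α → α < 1 →
    ∃ (n₀ : ℕ) (μ : ℝ), 0 < μ ∧
      ∀ (W : Type u) [Fintype W] [DecidableEq W] (H : KGraph k W),
        n₀ ≤ Fintype.card W → H.IsDense p μ →
        α * (Fintype.card W : ℝ) ^ (k - s) ≤ (H.minDegree s : ℝ) →
        Fintype.card V ∣ Fintype.card W →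
        HasFactor F H

/-- A `k`-partite realisation of `F`: a partition of the vertices into `k` nonempty classes, the
fibres of `χ`, such that every edge has exactly one vertex in each class. -/
def IsRealisation (F : KGraph k V) (χ : V → Fin k) : Prop :=
  Function.Surjective χ ∧ ∀ e ∈ F.edges, ∀ i, (e.filter fun v => χ v = i).card = 1

/-- `F` is `k`-partite if it admits a `k`-partite realisation. -/
def IsKPartite (F : KGraph k V) : Prop :=
  ∃ χ : V → Fin k, F.IsRealisation χ

/-- `F` is a complete `k`-partite `k`-graph: for some `k`-partite realisation, every vertex set
with exactly one vertex in each class is an edge. -/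
def IsCompleteKPartite (F : KGraph k V) : Prop :=
  ∃ χ : V → Fin k, F.IsRealisation χ ∧
    ∀ e : Finset V, (∀ i, (e.filter fun v => χ v = i).card = 1) → e ∈ F.edges

/-- The set `S(F)` of all sizes of vertex classes in `k`-partite realisations of `F`. -/
def classSizes (F : KGraph k V) : Set ℕ :=
  {m : ℕ | ∃ χ : V → Fin k, F.IsRealisation χ ∧
    ∃ i, m = (Finset.univ.filter fun v => χ v = i).card}

end KGraph

/-! Necessity is shown by a random construction. Suppose that `q > 1` divides every class size of a
complete `k`-partite `F`. Colour the vertices with two colours by `a`, colour the `(k - 1)`-sets at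
random by `g`, and let `e` be an edge if `g (e \ {v}) = a v` for all `v ∈ e`. Two transversals of
`F` that differ in one vertex share a `(k - 1)`-set, so in every copy of `F` each class is
monochromatic, and the number of vertices of colour `true` is a multiple of `q`. If the whole graph
has `1` modulo `q` such vertices, there is no factor (`dvd_card_of_hasFactor`). For suitable `g` the
graph is dense and has linear codegrees (`exists_isDense_switchGraph`). The concentration needs
independent events: the vertices form an abelian group, and distinct `k`-sets with the same sum
share no `(k - 1)`-set.

Sufficiency is an absorption argument. By density, every linear-sized set contains a copy of `F`, so
greedy tiling covers all but few vertices; the remainder is absorbed by a set prepared in advance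
(`exists_absorbing_set`). This requires a positive proportion of absorbers for every `v(F)`-tuple
`s` (`exists_le_freq_absorbs`), which are built as follows.

By the codegree condition each vertex `u` has a linear-sized cluster of vertices, almost all of
which share a dense common link with `u` and with each other (`CodegreeAtLeast.exists_cluster`). If
`u` and `v` share a dense link, many gadgets of `v(F) - 1` vertices form a copy of `F` with either
of them. So two vertices of one cluster can usually be exchanged. By density, copies of `F` exist
with their classes in prescribed clusters. It remains to find families `A` and `B` of such copies
for which `B` uses each cluster as often as `A` and `s` together. This is the statement that the
all-ones vector lies in the lattice spanned by the index vectors of labelled realisations, and it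
follows from `gcd = 1` (`one_mem_closure_index`). The absorber consists of `A`, `B` and one gadget
for each vertex of `B`: without `s`, the gadgets take the vertices of `B`; with `s`, they take those
of `A` and `s`.

All counts of copies rest on the Sidorenko property of complete `k`-partite `k`-graphs
(`expect_pow_le_expect_blowup`). -/

namespace KGraph

open Finset Filter
open scoped BigOperators Topology

universe u

/-! ### Proportions and averages over finite types -/

section Frequency

variable {α β ι κ X : Type*} [Fintype α] [Fintype β] [Fintype ι] [Fintype κ] [Fintype X]

open Classical in
/-- The real-valued truth value of a proposition. -/
noncomputable def ind (P : Prop) : ℝ := if P then 1 else 0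

lemma ind_nonneg (P : Prop) : 0 ≤ ind P := by unfold ind; split_ifs <;> norm_num

lemma ind_le_one (P : Prop) : ind P ≤ 1 := by unfold ind; split_ifs <;> norm_num

lemma ind_of {P : Prop} (h : P) : ind P = 1 := by simp [ind, h]

lemma ind_of_not {P : Prop} (h : ¬P) : ind P = 0 := by simp [ind, h]

lemma ind_mono {P Q : Prop} (h : P → Q) : ind P ≤ ind Q := by
  by_cases hP : P
  · rw [ind_of hP, ind_of (h hP)]
  · rw [ind_of_not hP]; exact ind_nonneg _

lemma ind_congr {P Q : Prop} (h : P ↔ Q) : ind P = ind Q := by rw [propext h]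

lemma ind_and (P Q : Prop) : ind (P ∧ Q) = ind P * ind Q := by
  by_cases hP : P <;> by_cases hQ : Q <;> simp [ind, hP, hQ]

lemma ind_forall (P : ι → Prop) : ind (∀ i, P i) = ∏ i, ind (P i) := by
  by_cases h : ∀ i, P i
  · rw [ind_of h, Finset.prod_eq_one fun i _ => ind_of (h i)]
  · rw [ind_of_not h]
    push Not at h
    obtain ⟨i, hi⟩ := h
    exact (Finset.prod_eq_zero (mem_univ i) (ind_of_not hi)).symm

lemma sum_ind {σ : Type*} (s : Finset σ) (P : σ → Prop) [DecidablePred P] :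
    ∑ x ∈ s, ind (P x) = ((s.filter P).card : ℝ) := by
  rw [card_filter]
  push_cast
  exact sum_congr rfl fun x _ => by by_cases h : P x <;> simp [ind, h]

/-- The proportion of the elements of a finite type that satisfy a predicate. -/
noncomputable def freq (P : α → Prop) : ℝ := 𝔼 x, ind (P x)

lemma freq_nonneg (P : α → Prop) : 0 ≤ freq P := expect_nonneg fun _ _ => ind_nonneg _

lemma freq_mono {P Q : α → Prop} (h : ∀ x, P x → Q x) : freq P ≤ freq Q :=
  expect_le_expect fun x _ => ind_mono (h x)

lemma freq_congr {P Q : α → Prop} (h : ∀ x, P x ↔ Q x) : freq P = freq Q :=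
  le_antisymm (freq_mono fun x => (h x).1) (freq_mono fun x => (h x).2)

lemma freq_or_le (P Q : α → Prop) : freq (fun x => P x ∨ Q x) ≤ freq P + freq Q := by
  unfold freq
  rw [← expect_add_distrib]
  refine expect_le_expect fun x _ => ?_
  by_cases hP : P x
  · rw [ind_of hP, ind_of (Or.inl hP)]; linarith [ind_nonneg (Q x)]
  · rw [ind_of_not hP, zero_add]; exact ind_mono fun h => h.resolve_left hP

lemma freq_le_add {P Q R : α → Prop} (h : ∀ x, P x → Q x ∨ R x) : freq P ≤ freq Q + freq R :=
  (freq_mono h).trans (freq_or_le _ _)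

lemma freq_exists_le (P : ι → α → Prop) :
    freq (fun x => ∃ i, P i x) ≤ ∑ i, freq (P i) := by
  unfold freq
  rw [← expect_sum_comm]
  refine expect_le_expect fun x _ => ?_
  by_cases h : ∃ i, P i x
  · obtain ⟨i, hi⟩ := h
    calc ind (∃ i, P i x) ≤ 1 := ind_le_one _
      _ = ind (P i x) := (ind_of hi).symm
      _ ≤ _ := single_le_sum (f := fun i => ind (P i x)) (fun _ _ => ind_nonneg _) (mem_univ i)
  · rw [ind_of_not h]; exact sum_nonneg fun _ _ => ind_nonneg _

lemma freq_eq_card (P : α → Prop) [DecidablePred P] :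
    freq P = ((univ.filter P).card : ℝ) / Fintype.card α := by
  unfold freq
  rw [Fintype.expect_eq_sum_div_card]
  congr 1
  exact sum_ind _ _

lemma exists_of_freq_pos {P : α → Prop} (h : 0 < freq P) : ∃ x, P x := by
  by_contra! hP
  have : freq P = 0 := expect_eq_zero fun x _ => ind_of_not (hP x)
  linarith

lemma freq_const_mem [Nonempty α] (P : Prop) : freq (fun _ : α => P) = ind P := by
  unfold freq; exact expect_const univ_nonempty _

lemma expect_prod_type (f : α × β → ℝ) : 𝔼 x, f x = 𝔼 a, 𝔼 b, f (a, b) := by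
  rw [← univ_product_univ, expect_product]

lemma freq_prod_type (P : α × β → Prop) : freq P = 𝔼 a, freq fun b => P (a, b) :=
  expect_prod_type _

lemma freq_equiv (e : α ≃ β) (P : β → Prop) : freq (fun x => P (e x)) = freq P :=
  expect_equiv e (by simp) (by simp)

lemma freq_fst [Nonempty β] (P : α → Prop) : freq (fun x : α × β => P x.1) = freq P := by
  rw [freq_prod_type]
  simp only [freq_const_mem]
  rfl

/-- The coordinates outside the range of `j` are free and average out. -/
lemma freq_comp [Nonempty X] [DecidableEq ι] [DecidableEq κ] (j : ι → κ)
    (hj : Function.Injective j)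
    (Q : (ι → X) → Prop) :
    freq (fun φ : κ → X => Q (φ ∘ j)) = freq Q := by
  classical
  let e₁ : ι ⊕ {x // x ∉ Set.range j} ≃ κ :=
    ((Equiv.ofInjective j hj).sumCongr (Equiv.refl _)).trans (Equiv.Set.sumCompl (Set.range j))
  let e : (κ → X) ≃ (ι → X) × ({x // x ∉ Set.range j} → X) :=
    (Equiv.arrowCongr e₁.symm (Equiv.refl X)).trans (Equiv.sumArrowEquivProdArrow _ _ _)
  rw [← freq_fst (β := {x // x ∉ Set.range j} → X) Q, ← freq_equiv e]
  refine freq_congr fun φ => ?_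
  have : (e φ).1 = φ ∘ j := by
    funext i
    simp only [e, e₁, Equiv.arrowCongr, Equiv.sumArrowEquivProdArrow, Equiv.trans_apply,
      Equiv.coe_fn_mk, Function.comp_apply, Equiv.symm_symm, Equiv.coe_refl, id_eq,
      Equiv.sumCongr_apply, Sum.map_inl, Equiv.ofInjective_apply]
    rfl
  rw [this]

lemma freq_le_of_comp [Nonempty X] [DecidableEq ι] [DecidableEq κ] (j : ι → κ)
    (hj : Function.Injective j)
    {P : (κ → X) → Prop} {Q : (ι → X) → Prop} (h : ∀ φ, P φ → Q (φ ∘ j)) : freq P ≤ freq Q := by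
  rw [← freq_comp j hj Q]
  exact freq_mono h

lemma freq_eval [Nonempty X] [DecidableEq ι] (i : ι) (Q : X → Prop) :
    freq (fun φ : ι → X => Q (φ i)) = freq Q := by
  rw [← freq_equiv (Equiv.funUnique Unit X) Q]
  rw [← freq_comp (fun _ : Unit => i) (fun _ _ _ => rfl)]
  rfl

lemma freq_eval_pair [Nonempty X] [DecidableEq ι] {i j : ι} (hij : i ≠ j) (Q : X → X → Prop) :
    freq (fun φ : ι → X => Q (φ i) (φ j)) = freq (fun x : X × X => Q x.1 x.2) := by
  rw [← freq_equiv (finTwoArrowEquiv X) (fun x : X × X => Q x.1 x.2)]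
  rw [← freq_comp ![i, j] (by
    intro a b hab; fin_cases a <;> fin_cases b <;> simp_all [hij.symm])]
  rfl

lemma freq_forall [DecidableEq ι] (P : ι → X → Prop) :
    freq (fun φ : ι → X => ∀ i, P i (φ i)) = ∏ i, freq (P i) := by
  unfold freq
  simp only [ind_forall, Fintype.expect_eq_sum_div_card]
  rw [prod_div_distrib, Finset.prod_univ_sum]
  simp

lemma freq_mem (s : Finset X) : freq (fun x => x ∈ s) = (s.card : ℝ) / Fintype.card X := by
  classical
  rw [freq_eq_card]; simp

lemma freq_eval_eq [Nonempty X] [DecidableEq ι] (i : ι) (w : X) :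
    freq (fun φ : ι → X => φ i = w) = 1 / Fintype.card X := by
  classical
  rw [freq_eval i (fun x => x = w), freq_congr (Q := fun x => x ∈ ({w} : Finset X)) (by simp),
    freq_mem]
  simp

lemma freq_eval_eq_eval [Nonempty X] [DecidableEq ι] {i j : ι} (hij : i ≠ j) :
    freq (fun φ : ι → X => φ i = φ j) = 1 / Fintype.card X := by
  classical
  rw [freq_eval_pair hij (fun x y => x = y), freq_prod_type]
  have : ∀ a : X, freq (fun b => a = b) = 1 / Fintype.card X := by
    intro a
    rw [freq_eq_card, Finset.filter_eq]
    simp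
  simp only [this]
  exact expect_const univ_nonempty _

lemma freq_not_injective_le [Nonempty X] [DecidableEq ι] :
    freq (fun φ : ι → X => ¬Function.Injective φ) ≤
      (Fintype.card ι : ℝ) ^ 2 / Fintype.card X := by
  calc freq (fun φ : ι → X => ¬Function.Injective φ)
      ≤ freq (fun φ : ι → X => ∃ p : ι × ι, p.1 ≠ p.2 ∧ φ p.1 = φ p.2) := by
        refine freq_mono fun φ h => ?_
        simp only [Function.Injective] at h
        push Not at h
        obtain ⟨a, b, hab, hne⟩ := h
        exact ⟨(a, b), hne, hab⟩
    _ ≤ ∑ p : ι × ι, freq (fun φ : ι → X => p.1 ≠ p.2 ∧ φ p.1 = φ p.2) := freq_exists_le _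
    _ ≤ ∑ p : ι × ι, 1 / (Fintype.card X : ℝ) := by
        refine sum_le_sum fun p _ => ?_
        by_cases hp : p.1 = p.2
        · refine le_trans (le_of_eq ?_) (by positivity : (0 : ℝ) ≤ _)
          exact expect_eq_zero fun x _ => ind_of_not (by simp [hp])
        · exact (freq_mono fun φ h => h.2).trans (freq_eval_eq_eval hp).le
    _ = _ := by
        simp only [sum_const, card_univ, Fintype.card_prod, nsmul_eq_mul]
        push_cast; ring

/-- Exchanging the coordinate `i` with an independent point is an involution: resampling one
coordinate preserves the uniform distribution. -/
lemma expect_update [DecidableEq ι] (i : ι) (f : (ι → X) → ℝ) :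
    𝔼 x, 𝔼 w, f (Function.update x i w) = 𝔼 x, f x := by
  rcases isEmpty_or_nonempty X with h | h
  · have : IsEmpty (ι → X) := ⟨fun f => h.false (f i)⟩
    simp
  let e : (ι → X) × X ≃ (ι → X) × X :=
    { toFun := fun p => (Function.update p.1 i p.2, p.1 i)
      invFun := fun p => (Function.update p.1 i p.2, p.1 i)
      left_inv := fun p => by simp
      right_inv := fun p => by simp }
  calc 𝔼 x, 𝔼 w, f (Function.update x i w)
      = 𝔼 p : (ι → X) × X, f (e p).1 := (expect_prod_type fun p => f (e p).1).symm
    _ = 𝔼 p : (ι → X) × X, f p.1 := expect_equiv e (by simp) (by simp)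
    _ = 𝔼 x, 𝔼 _w : X, f x := expect_prod_type _
    _ = _ := by simp only [expect_const univ_nonempty]

end Frequency

/-! ### Sidorenko's inequality for blow-ups -/

section Blowup

variable {ι X T : Type*} [Fintype ι] [Fintype X] [Fintype T]
  [DecidableEq T]

lemma expect_prod_eval [DecidableEq ι] (h : ι → X → ℝ) :
    𝔼 φ : ι → X, ∏ i, h i (φ i) = ∏ i, 𝔼 x, h i x := by
  simp only [Fintype.expect_eq_sum_div_card]
  rw [prod_div_distrib, Finset.prod_univ_sum]
  simp

lemma expect_pow_le_expect_pow [Nonempty X] (g : X → ℝ) (hg : ∀ x, 0 ≤ g x) (m : ℕ) :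
    (𝔼 x, g x) ^ m ≤ 𝔼 x, g x ^ m := by
  have hc : (Fintype.card X : ℝ) ≠ 0 := by simp
  have := Real.pow_arith_mean_le_arith_mean_pow univ (fun _ : X => 1 / (Fintype.card X : ℝ)) g
    (fun _ _ => by positivity) (by simp) (fun x _ => hg x) m
  rw [← mul_sum, ← mul_sum, one_div_mul_eq_div, one_div_mul_eq_div] at this
  rwa [Fintype.expect_eq_sum_div_card, Fintype.expect_eq_sum_div_card]

lemma expect_cons {k : ℕ} (f : (Fin (k + 1) → X) → ℝ) :
    𝔼 x, f x = 𝔼 w, 𝔼 x, f (Fin.cons w x) := by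
  rw [← expect_prod_type fun p : X × (Fin k → X) => f (Fin.cons p.1 p.2)]
  exact (expect_equiv (Fin.consEquiv fun _ => X) (by simp) (by simp [Fin.consEquiv])).symm

/-- The Sidorenko property of complete `k`-partite `k`-graphs. -/
lemma expect_pow_le_expect_blowup [Nonempty X] {k : ℕ} (f : (Fin k → X) → ℝ)
    (hf : ∀ x, 0 ≤ f x) :
    (𝔼 x, f x) ^ (Fintype.card T ^ k) ≤
      𝔼 φ : Fin k → T → X, ∏ s : Fin k → T, f (fun i => φ i (s i)) := by
  classical
  induction k with
  | zero =>
    have h₁ : ∀ (x : Fin 0 → X) (y : Fin 0 → X), f x = f y := fun x y => by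
      rw [Subsingleton.elim x y]
    simp
    exact (h₁ _ _).le
  | succ k ih =>
    set t := Fintype.card T
    -- The first coordinate is blown up and the other `k` are left to the induction. Jensen's
    -- inequality is used twice, over `x` and then over the blown-up coordinate `y`.
    let g : (T → X) → (Fin k → X) → ℝ := fun y x => ∏ j, f (Fin.cons (y j) x)
    have hg : ∀ y x, 0 ≤ g y x := fun y x => prod_nonneg fun _ _ => hf _
    calc (𝔼 x, f x) ^ (t ^ (k + 1))
        = ((𝔼 x, 𝔼 w, f (Fin.cons w x)) ^ t) ^ (t ^ k) := by
          rw [expect_cons, expect_comm, ← pow_mul, pow_succ']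
      _ ≤ (𝔼 x, (𝔼 w, f (Fin.cons w x)) ^ t) ^ (t ^ k) := by
          refine pow_le_pow_left₀ (pow_nonneg ?_ _) (expect_pow_le_expect_pow _ ?_ _) _
          · exact expect_nonneg fun _ _ => expect_nonneg fun _ _ => hf _
          · exact fun _ => expect_nonneg fun _ _ => hf _
      _ = (𝔼 y, 𝔼 x, g y x) ^ (t ^ k) := by
          rw [expect_comm]
          congr 2
          funext x
          rw [expect_prod_eval (fun (_ : T) w => f (Fin.cons w x))]
          simp [t]
      _ ≤ 𝔼 y, (𝔼 x, g y x) ^ (t ^ k) :=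
          expect_pow_le_expect_pow _ (fun y => expect_nonneg fun _ _ => hg _ _) _
      _ ≤ 𝔼 y, 𝔼 φ : Fin k → T → X, ∏ s : Fin k → T, g y (fun i => φ i (s i)) :=
          expect_le_expect fun y _ => ih (g y) (hg y)
      _ = _ := by
          rw [expect_cons (X := T → X)]
          congr 1
          funext y
          congr 1
          funext φ
          rw [← Fintype.prod_equiv (Fin.consEquiv fun _ => T)
            (fun p => f fun i => (Fin.cons y φ : Fin (k + 1) → T → X) i
              ((Fin.cons p.1 p.2 : Fin (k + 1) → T) i)) _ (fun p => rfl), Fintype.prod_prod_type,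
            Finset.prod_comm]
          refine prod_congr rfl fun s _ => prod_congr rfl fun j _ => congrArg f ?_
          funext i
          refine Fin.cases ?_ (fun i => ?_) i <;> simp

lemma pow_freq_le_freq_blowup [Nonempty X] {k : ℕ} (P : (Fin k → X) → Prop) :
    freq P ^ (Fintype.card T ^ k) ≤
      freq fun φ : Fin k × T → X => ∀ s : Fin k → T, P fun i => φ (i, s i) := by
  classical
  rw [← freq_equiv (Equiv.curry (Fin k) T X).symm]
  refine (expect_pow_le_expect_blowup (T := T) (fun x => ind (P x)) fun _ => ind_nonneg _).trans ?_
  refine expect_le_expect fun φ _ => ?_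
  rw [ind_forall]
  rfl

end Blowup

/-! ### Concentration for random colourings -/

section RandomColouring

variable {Ω σ : Type*} [Fintype Ω] [DecidableEq Ω] [DecidableEq σ]

/-- Independence: `h` does not look at `D`, so the points of `D` may be resampled one at a time,
each contributing a factor `1 / 2`. -/
lemma expect_mul_ind_agree (h : (Ω → Bool) → ℝ) (t : Ω → Bool) (D : Finset Ω)
    (hD : ∀ g g' : Ω → Bool, (∀ ω, ω ∉ D → g ω = g' ω) → h g = h g') :
    𝔼 g, h g * ind (∀ ω ∈ D, g ω = t ω) = (1 / 2) ^ D.card * 𝔼 g, h g := by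
  induction D using Finset.induction_on with
  | empty => simp [ind]
  | insert a D ha ih =>
    have hD' : ∀ g g' : Ω → Bool, (∀ ω, ω ∉ D → g ω = g' ω) → h g = h g' := fun g g' hg =>
      hD g g' fun ω hω => hg ω fun h => hω (mem_insert_of_mem h)
    rw [card_insert_of_notMem ha, pow_succ', mul_assoc, ← ih hD', mul_expect,
      ← expect_update a]
    refine expect_congr rfl fun g _ => ?_
    have h₁ : ∀ b, h (Function.update g a b) = h g := fun b => hD _ _ fun ω hω => by
      rw [Function.update_of_ne]; rintro rfl; exact hω (mem_insert_self _ _)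
    have h₂ : ∀ b, ind (∀ ω ∈ insert a D, Function.update g a b ω = t ω) =
        ind (b = t a) * ind (∀ ω ∈ D, g ω = t ω) := fun b => by
      rw [← ind_and]
      refine ind_congr ?_
      rw [forall_mem_insert, Function.update_self]
      refine and_congr_right fun _ => forall₂_congr fun ω hω => ?_
      rw [Function.update_of_ne]; rintro rfl; exact ha hω
    have h₃ : 𝔼 b, ind (b = t a) = 1 / 2 := by
      rw [Fintype.expect_eq_sum_div_card]
      cases t a <;> simp [ind]
    simp only [h₁, h₂]
    rw [← mul_expect, ← expect_mul, h₃]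
    ring

lemma exp_neg_ind (P : Prop) : Real.exp (-ind P) = 1 - (1 - Real.exp (-1)) * ind P := by
  by_cases h : P
  · simp [ind_of h]
  · simp [ind_of_not h]

lemma half_le_one_sub_exp_neg_one : (1 : ℝ) / 2 ≤ 1 - Real.exp (-1) := by
  have h1 : (2 : ℝ) ≤ Real.exp 1 := by linarith [Real.add_one_le_exp (1 : ℝ)]
  rw [Real.exp_neg]
  have := inv_anti₀ (by norm_num) h1
  linarith

/-- An exponential moment bound: among events that prescribe a random colouring on disjoint
sets of at most `k` points, at least the expected proportion occurs. -/
lemma expect_exp_neg_agree_le {k : ℕ} (J : Finset σ) (D : σ → Finset Ω) (t : σ → Ω → Bool)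
    (hk : ∀ j ∈ J, (D j).card ≤ k)
    (hdisj : ∀ i ∈ J, ∀ j ∈ J, i ≠ j → Disjoint (D i) (D j)) :
    𝔼 g : Ω → Bool, Real.exp (-∑ j ∈ J, ind (∀ ω ∈ D j, g ω = t j ω)) ≤
      Real.exp (-((1 / 2) ^ (k + 1) * J.card)) := by
  induction J using Finset.induction_on with
  | empty => simp
  | insert a J ha ih =>
    set h : (Ω → Bool) → ℝ := fun g => Real.exp (-∑ j ∈ J, ind (∀ ω ∈ D j, g ω = t j ω)) with hh
    have hpos : ∀ g, 0 ≤ h g := fun g => (Real.exp_pos _).le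
    have hsplit : ∀ g : Ω → Bool,
        Real.exp (-∑ j ∈ insert a J, ind (∀ ω ∈ D j, g ω = t j ω)) =
          h g - (1 - Real.exp (-1)) * (h g * ind (∀ ω ∈ D a, g ω = t a ω)) := fun g => by
      rw [sum_insert ha, neg_add, Real.exp_add, exp_neg_ind]
      simp only [hh]; ring
    have hind : ∀ g g' : Ω → Bool, (∀ ω, ω ∉ D a → g ω = g' ω) → h g = h g' := fun g g' hg => by
      simp only [hh]
      congr 2
      refine sum_congr rfl fun j hj => ind_congr <| forall₂_congr fun ω hω => ?_
      rw [hg ω]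
      have := hdisj a (mem_insert_self _ _) j (mem_insert_of_mem hj) (by rintro rfl; exact ha hj)
      exact fun h' => disjoint_left.1 this h' hω
    simp only [hsplit]
    rw [expect_sub_distrib, ← mul_expect, expect_mul_ind_agree h (t a) (D a) hind]
    have hE : 0 ≤ 𝔼 g, h g := expect_nonneg fun g _ => hpos g
    have ih' := ih (fun j hj => hk j (mem_insert_of_mem hj))
      (fun i hi j hj => hdisj i (mem_insert_of_mem hi) j (mem_insert_of_mem hj))
    have hp : (1 / 2 : ℝ) ^ k ≤ (1 / 2) ^ (D a).card :=
      pow_le_pow_of_le_one (by norm_num) (by norm_num) (hk a (mem_insert_self _ _))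
    -- One factor `1 / 2` is a lower bound for `1 - exp (-1)`; the other `k` bound the probability
    -- of agreement on `D a`.
    have hq : (1 / 2 : ℝ) ^ (k + 1) ≤ (1 - Real.exp (-1)) * (1 / 2) ^ (D a).card := by
      rw [pow_succ']
      exact mul_le_mul half_le_one_sub_exp_neg_one hp (by positivity)
        (by linarith [half_le_one_sub_exp_neg_one])
    calc 𝔼 g, h g - (1 - Real.exp (-1)) * ((1 / 2) ^ (D a).card * 𝔼 g, h g)
        = (1 - (1 - Real.exp (-1)) * (1 / 2) ^ (D a).card) * 𝔼 g, h g := by ring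
      _ ≤ (1 - (1 / 2) ^ (k + 1)) * 𝔼 g, h g := by gcongr
      _ ≤ Real.exp (-(1 / 2) ^ (k + 1)) * Real.exp (-((1 / 2) ^ (k + 1) * J.card)) := by
          refine mul_le_mul ?_ ih' hE (Real.exp_pos _).le
          linarith [Real.add_one_le_exp (-(1 / 2 : ℝ) ^ (k + 1))]
      _ = _ := by
          rw [← Real.exp_add, card_insert_of_notMem ha]
          push_cast
          congr 1; ring

lemma freq_lt_sub_le_exp {α : Type*} [Fintype α] (Y : α → ℝ) (a l : ℝ)
    (h : 𝔼 x, Real.exp (-Y x) ≤ Real.exp (-a)) :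
    freq (fun x => Y x < a - l) ≤ Real.exp (-l) := by
  calc freq (fun x => Y x < a - l)
      ≤ 𝔼 x, Real.exp (-Y x) * Real.exp (a - l) := by
        refine expect_le_expect fun x _ => ?_
        rw [← Real.exp_add]
        by_cases hx : Y x < a - l
        · rw [ind_of hx, Real.one_le_exp_iff]; linarith
        · rw [ind_of_not hx]; exact (Real.exp_pos _).le
    _ ≤ Real.exp (-a) * Real.exp (a - l) := by
        rw [← expect_mul]; gcongr
    _ = _ := by rw [← Real.exp_add]; congr 1; ring

lemma freq_agree_lt_le {k : ℕ} (J : Finset σ) (D : σ → Finset Ω) (t : σ → Ω → Bool)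
    (hk : ∀ j ∈ J, (D j).card ≤ k)
    (hdisj : ∀ i ∈ J, ∀ j ∈ J, i ≠ j → Disjoint (D i) (D j)) (l : ℝ) :
    freq (fun g : Ω → Bool => ∑ j ∈ J, ind (∀ ω ∈ D j, g ω = t j ω) <
      (1 / 2) ^ (k + 1) * J.card - l) ≤ Real.exp (-l) :=
  freq_lt_sub_le_exp _ _ l (expect_exp_neg_agree_le J D t hk hdisj)

end RandomColouring

/-! ### The random switch graph: codegrees and density -/

section SwitchGraph

variable {k : ℕ} {W : Type*} [Fintype W] [DecidableEq W]

/-- The `k`-graph whose edges `e` satisfy `g (e \ {v}) = a v` for all `v ∈ e`: the colour that `g`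
gives to a `(k - 1)`-set is the colour `a` of all its neighbours. -/
def switchGraph (k : ℕ) (a : W → Bool) (g : Finset W → Bool) : KGraph k W where
  edges := univ.filter fun e => e.card = k ∧ ∀ v ∈ e, g (e.erase v) = a v
  uniform _ he := (mem_filter.1 he).2.1

lemma mem_edges_switchGraph {a : W → Bool} {g : Finset W → Bool} {e : Finset W} :
    e ∈ (switchGraph k a g).edges ↔ e.card = k ∧ ∀ v ∈ e, g (e.erase v) = a v := by
  simp [switchGraph]

/-- The colour that the set `R`, obtained from `e` by removing a vertex, must have in order that
`e` be an edge of the switch graph. -/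
def switchTarget (a : W → Bool) (e R : Finset W) : Bool := decide (∃ v ∈ e \ R, a v = true)

lemma switchTarget_erase (a : W → Bool) {e : Finset W} {v : W} (hv : v ∈ e) :
    switchTarget a e (e.erase v) = a v := by
  simp [switchTarget, sdiff_erase hv]

/-- If `a w = g S`, the condition for `insert w S` to be an edge that concerns `S` itself already
holds; only its other `(k - 1)`-subsets remain to be tested. -/
lemma sum_ind_le_deg {S : Finset W} (hS : S.card + 1 = k) (a : W → Bool) (g : Finset W → Bool) :
    ∑ w ∈ univ.filter (fun w => w ∉ S ∧ a w = g S),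
      ind (∀ R ∈ S.image fun u => (insert w S).erase u, g R = switchTarget a (insert w S) R) ≤
      ((switchGraph k a g).deg S : ℝ) := by
  classical
  rw [sum_ind]
  norm_cast
  refine card_le_card_of_injOn (fun w => insert w S) ?_ ?_
  · intro w hw
    simp only [coe_filter, mem_filter, mem_univ, true_and, Set.mem_ofPred_eq] at hw
    simp only [coe_filter, Set.mem_ofPred_eq, mem_edges_switchGraph]
    obtain ⟨⟨hwS, hwa⟩, hw⟩ := hw
    refine ⟨⟨by rw [card_insert_of_notMem hwS, hS], fun v hv => ?_⟩, subset_insert _ _⟩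
    rcases mem_insert.1 hv with rfl | hvS
    · rw [erase_insert hwS, hwa]
    · rw [hw _ (mem_image_of_mem _ hvS), switchTarget_erase a hv]
  · intro w hw w' hw' h
    simp only [coe_filter, mem_filter, mem_univ, true_and, Set.mem_ofPred_eq] at hw hw'
    have h' : insert w S = insert w' S := h
    have : w ∈ insert w' S := h' ▸ mem_insert_self w S
    exact (mem_insert.1 this).resolve_right hw.1.1

/-- The sets tested for `w` contain `w` as their only vertex outside `S`, so different `w` test
disjoint families of sets. -/
lemma freq_deg_lt_le {S : Finset W} (hS : S.card + 1 = k) (a : W → Bool) (m l : ℝ)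
    (ha : ∀ c, m + k ≤ ((univ.filter fun w => a w = c).card : ℝ)) :
    freq (fun g : Finset W → Bool =>
      ((switchGraph k a g).deg S : ℝ) < (1 / 2) ^ (k + 1) * m - l) ≤ 2 * Real.exp (-l) := by
  classical
  have hJ : ∀ c, m ≤ ((univ.filter fun w => w ∉ S ∧ a w = c).card : ℝ) := by
    intro c
    have h₁ : univ.filter (fun w => a w = c) ⊆ univ.filter (fun w => w ∉ S ∧ a w = c) ∪ S := by
      intro w hw
      by_cases hwS : w ∈ S <;> simp_all
    have h₂ := (card_le_card h₁).trans (card_union_le _ _)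
    have h₃ : ((univ.filter fun w => a w = c).card : ℝ) ≤
      ((univ.filter fun w => w ∉ S ∧ a w = c).card : ℝ) + k := by
      rw [← hS]; norm_cast; omega
    linarith [ha c]
  -- The index set of the sum depends on the random colour `g S`. A union bound over its two values
  -- fixes it and causes the factor `2`.
  refine (freq_mono (Q := fun g => ∃ c : Bool,
    ∑ w ∈ univ.filter (fun w => w ∉ S ∧ a w = c),
      ind (∀ R ∈ S.image fun u => (insert w S).erase u, g R = switchTarget a (insert w S) R) <
      (1 / 2) ^ (k + 1) * ((univ.filter fun w => w ∉ S ∧ a w = c).card : ℝ) - l)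
    fun g hg => ⟨g S, ?_⟩).trans ((freq_exists_le _).trans ?_)
  · refine (sum_ind_le_deg hS a g).trans_lt (hg.trans_le ?_)
    gcongr
    exact hJ _
  · calc _ ≤ ∑ c : Bool, Real.exp (-l) := sum_le_sum fun c _ => ?_
      _ = _ := by simp
    refine freq_agree_lt_le _ (fun w => S.image fun u => (insert w S).erase u)
      (fun w => switchTarget a (insert w S)) ?_ ?_ l
    · intro w _
      exact card_image_le.trans (by omega)
    · intro w hw w' hw' hne
      simp only [mem_filter, mem_univ, true_and] at hw hw'
      rw [disjoint_left]
      intro R hR hR'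
      obtain ⟨u, hu, rfl⟩ := mem_image.1 hR
      obtain ⟨u', hu', hEq⟩ := mem_image.1 hR'
      have : w ∈ (insert w' S).erase u' := by
        rw [hEq]
        exact mem_erase.2 ⟨by rintro rfl; exact hw.1 hu, mem_insert_self _ _⟩
      rcases mem_insert.1 (mem_of_mem_erase this) with h | h
      exacts [hne h, hw.1 h]

variable [AddCommGroup W]

/-- The `k`-sets with elements in `X 1, …, X k` and with sum `s`. -/
def transversalsWithSum (X : Fin k → Finset W) (s : W) : Finset (Finset W) :=
  univ.filter fun e => e.card = k ∧ (∃ x ∈ Fintype.piFinset X, univ.image x = e) ∧ ∑ v ∈ e, v = s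

/-- Each `k`-set is the image of at most `k ^ k` tuples, and tuples with a repeated entry are few.
The group structure enters only to split the `k`-sets by their sums. -/
lemma prod_card_le (X : Fin k → Finset W) :
    (∏ i, ((X i).card : ℝ)) ≤ k ^ k * ∑ s, ((transversalsWithSum X s).card : ℝ) +
      (k : ℝ) ^ 2 / Fintype.card W * (Fintype.card W : ℝ) ^ k := by
  classical
  have hW : Nonempty W := ⟨0⟩
  have hW0 : (Fintype.card W : ℝ) ≠ 0 := by simp
  set B := univ.biUnion (transversalsWithSum X) with hB
  have hBcard : ∑ s, ((transversalsWithSum X s).card : ℝ) = B.card := by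
    rw [hB, card_biUnion]
    · push_cast; rfl
    · intro s _ s' _ hne
      rw [Function.onFun, disjoint_left]
      intro e he he'
      simp only [transversalsWithSum, mem_filter] at he he'
      exact hne (he.2.2.2.symm.trans he'.2.2.2)
  have h₁ : ((Fintype.piFinset X).filter fun x => Function.Injective x).card ≤ k ^ k * B.card := by
    refine card_le_mul_card_image_of_maps_to (f := fun x => univ.image x) ?_ _ ?_
    · intro x hx
      rw [mem_filter] at hx
      simp only [hB, transversalsWithSum, mem_biUnion, mem_univ, true_and, mem_filter]
      refine ⟨_, ?_, ⟨x, hx.1, rfl⟩, rfl⟩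
      rw [card_image_of_injective _ hx.2, card_univ, Fintype.card_fin]
    · intro e he
      have hek : e.card = k := by
        simp only [hB, transversalsWithSum, mem_biUnion, mem_filter] at he
        obtain ⟨s, -, -, h, -⟩ := he
        exact h
      calc _ ≤ (Fintype.piFinset fun _ : Fin k => e).card := by
            refine card_le_card fun x hx => ?_
            rw [mem_filter] at hx
            rw [Fintype.mem_piFinset]
            intro i
            rw [← hx.2]
            exact mem_image_of_mem _ (mem_univ i)
        _ = k ^ k := by simp [hek]
  have h₂ : ((univ.filter fun x : Fin k → W => ¬Function.Injective x).card : ℝ) ≤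
      (k : ℝ) ^ 2 / Fintype.card W * (Fintype.card W : ℝ) ^ k := by
    have := freq_not_injective_le (ι := Fin k) (X := W)
    rw [freq_eq_card, Fintype.card_fin, div_le_iff₀ (by positivity)] at this
    simpa using this
  have h₃ : (Fintype.piFinset X).card ≤
      ((Fintype.piFinset X).filter fun x => Function.Injective x).card +
      (univ.filter fun x : Fin k → W => ¬Function.Injective x).card := by
    rw [← card_filter_add_card_filter_not (s := Fintype.piFinset X) (fun x => Function.Injective x)]
    gcongr
    exact subset_univ _
  rw [Fintype.card_piFinset] at h₃
  have h₄ : ((∏ i, (X i).card : ℕ) : ℝ) ≤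
      ((((Fintype.piFinset X).filter fun x => Function.Injective x).card +
      (univ.filter fun x : Fin k → W => ¬Function.Injective x).card : ℕ) : ℝ) := by
    exact_mod_cast h₃
  have h₅ : (((Fintype.piFinset X).filter fun x => Function.Injective x).card : ℝ) ≤
      k ^ k * B.card := by exact_mod_cast h₁
  push_cast at h₄
  rw [hBcard]
  linarith

lemma sum_ind_le_edgeTuples (X : Fin k → Finset W) (a : W → Bool) (g : Finset W → Bool) :
    ∑ s, ∑ e ∈ transversalsWithSum X s,
      ind (∀ R ∈ e.image fun v => e.erase v, g R = switchTarget a e R) ≤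
      ((switchGraph k a g).edgeTuples X : ℝ) := by
  classical
  rw [← sum_biUnion]
  · rw [sum_ind]
    norm_cast
    refine (card_le_card ?_).trans (card_image_le (f := fun x => univ.image x))
    intro e he
    simp only [transversalsWithSum, mem_filter, mem_biUnion, mem_univ, true_and] at he
    obtain ⟨⟨s, hk, ⟨x, hx, rfl⟩, -⟩, he⟩ := he
    refine mem_image.2 ⟨x, mem_filter.2 ⟨hx, mem_edges_switchGraph.2 ⟨hk, fun v hv => ?_⟩⟩, rfl⟩
    rw [he _ (mem_image_of_mem _ hv), switchTarget_erase a hv]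
  · intro s _ s' _ hne
    rw [Function.onFun, disjoint_left]
    intro e he he'
    simp only [transversalsWithSum, mem_filter] at he he'
    exact hne (he.2.2.2.symm.trans he'.2.2.2)

/-- Two `k`-sets with the same sum and a common `(k - 1)`-subset have the same remaining vertex.
Hence within one sum the colour conditions live on disjoint families. -/
lemma freq_transversals_lt_le (X : Fin k → Finset W) (s : W) (a : W → Bool) (l : ℝ) :
    freq (fun g : Finset W → Bool => ∑ e ∈ transversalsWithSum X s,
      ind (∀ R ∈ e.image fun v => e.erase v, g R = switchTarget a e R) <
      (1 / 2) ^ (k + 1) * ((transversalsWithSum X s).card : ℝ) - l) ≤ Real.exp (-l) := by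
  refine freq_agree_lt_le (transversalsWithSum X s) (fun e => e.image fun v => e.erase v)
    (fun e => switchTarget a e) ?_ ?_ l
  · intro e he
    simp only [transversalsWithSum, mem_filter] at he
    exact card_image_le.trans he.2.1.le
  · intro e he e' he' hne
    simp only [transversalsWithSum, mem_filter] at he he'
    rw [disjoint_left]
    intro R hR hR'
    obtain ⟨v, hv, rfl⟩ := mem_image.1 hR
    obtain ⟨v', hv', h⟩ := mem_image.1 hR'
    have h₁ := add_sum_erase e (fun x => x) hv
    have h₂ := add_sum_erase e' (fun x => x) hv'
    rw [h, he'.2.2.2, ← he.2.2.2, ← h₁] at h₂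
    have hvv : v' = v := add_right_cancel h₂
    apply hne
    rw [← insert_erase hv, ← insert_erase hv', h, hvv]

end SwitchGraph

lemma exists_not_of_freq_lt_one {α : Type*} [Fintype α] [Nonempty α] {P : α → Prop}
    (h : freq P < 1) : ∃ x, ¬P x := by
  by_contra! hP
  have : freq P = 1 := by
    unfold freq
    simp only [fun x => ind_of (hP x)]
    exact expect_const univ_nonempty _
  linarith

lemma eventually_pow_mul_exp_neg_lt (k : ℕ) {C c ε : ℝ} (hc : 0 < c) (hε : 0 < ε) :
    ∀ᶠ n : ℕ in atTop, C * (n : ℝ) ^ k * Real.exp (-(c * n)) < ε := by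
  have h₁ : Tendsto (fun n : ℕ => c * (n : ℝ)) atTop atTop :=
    tendsto_natCast_atTop_atTop.const_mul_atTop hc
  have h₂ := ((Real.tendsto_pow_mul_exp_neg_atTop_nhds_zero k).comp h₁).const_mul (C / c ^ k)
  rw [mul_zero] at h₂
  filter_upwards [h₂.eventually_lt_const hε] with n hn
  refine lt_of_eq_of_lt ?_ hn
  simp only [Function.comp_apply, mul_pow]
  field_simp

/-- Two union bounds: over the at most `n ^ k` sets `S` against `exp (-δn/8)`, and over the `2 ^
(kn) * n` choices of vertex sets and a sum against `exp (-μn²/2)`. -/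
lemma exists_isDense_switchGraph {k : ℕ} (hk : 3 ≤ k) {μ : ℝ} (hμ : 0 < μ) :
    ∃ N : ℕ, ∀ (W : Type u) [Fintype W] [DecidableEq W] [AddCommGroup W] (a : W → Bool),
      N ≤ Fintype.card W →
      (∀ c, (Fintype.card W : ℝ) / 3 ≤ ((univ.filter fun w => a w = c).card : ℝ)) →
      ∃ g : Finset W → Bool, (switchGraph k a g).IsDense ((1 / 2) ^ (k + 1) / k ^ k) μ ∧
        ∀ S : Finset W, S.card + 1 = k →
          (1 / 2) ^ (k + 1) / 8 * (Fintype.card W : ℝ) ≤ ((switchGraph k a g).deg S : ℝ) := by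
  set δ : ℝ := (1 / 2) ^ (k + 1) with hδ
  have hδ0 : 0 < δ := by positivity
  have hev : ∀ᶠ n : ℕ in atTop, 2 * (n : ℝ) ^ k * Real.exp (-(δ / 8 * n)) < 1 / 2 ∧
      1 ≤ (n : ℝ) ∧ 2 * k ^ 2 / μ ≤ (n : ℝ) ∧ 12 * (k : ℝ) ≤ n ∧ 2 * (k + 2) / μ ≤ (n : ℝ) := by
    refine (eventually_pow_mul_exp_neg_lt k (by positivity) (by norm_num)).and ?_
    have h := tendsto_natCast_atTop_atTop (R := ℝ)
    exact (h.eventually_ge_atTop _).and <| (h.eventually_ge_atTop _).and <|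
      (h.eventually_ge_atTop _).and (h.eventually_ge_atTop _)
  obtain ⟨N, hN⟩ := eventually_atTop.1 hev
  refine ⟨N, fun W _ _ _ a hW ha => ?_⟩
  obtain ⟨hn₁, hn₂, hn₃, hn₄, hn₅⟩ := hN _ hW
  set n : ℝ := (Fintype.card W : ℝ) with hn
  have hn0 : 0 < n := by linarith
  let bad₁ : (Finset W → Bool) → Prop := fun g => ∃ S : {S : Finset W // S.card + 1 = k},
    ((switchGraph k a g).deg S.1 : ℝ) < δ * (n / 4) - δ / 8 * n
  let bad₂ : (Finset W → Bool) → Prop := fun g => ∃ p : (Fin k → Finset W) × W,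
    ∑ e ∈ transversalsWithSum p.1 p.2,
      ind (∀ R ∈ e.image fun v => e.erase v, g R = switchTarget a e R) <
      δ * ((transversalsWithSum p.1 p.2).card : ℝ) - μ / 2 * n ^ 2
  have hbad₁ : freq bad₁ < 1 / 2 := by
    refine lt_of_le_of_lt ((freq_exists_le _).trans (sum_le_sum fun S _ =>
      freq_deg_lt_le S.2 a (n / 4) (δ / 8 * n) fun c => ?_)) ?_
    · linarith [ha c]
    · refine lt_of_le_of_lt ?_ hn₁
      rw [sum_const, nsmul_eq_mul, card_univ]
      have hcard : (Fintype.card {S : Finset W // S.card + 1 = k} : ℝ) ≤ n ^ k := by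
        have h₁ : Fintype.card {S : Finset W // S.card + 1 = k} ≤
            (Fintype.card W) ^ (k - 1) := by
          rw [Fintype.card_subtype]
          calc _ ≤ (powersetCard (k - 1) (univ : Finset W)).card := by
                refine card_le_card fun S hS => ?_
                rw [mem_filter] at hS
                rw [mem_powersetCard]
                exact ⟨subset_univ _, by omega⟩
            _ ≤ _ := by
                rw [card_powersetCard]; exact Nat.choose_le_pow _ _
        calc (Fintype.card {S : Finset W // S.card + 1 = k} : ℝ) ≤ n ^ (k - 1) := by
              rw [hn]; exact_mod_cast h₁
          _ ≤ n ^ k := pow_le_pow_right₀ hn₂ (by omega)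
      calc _ ≤ n ^ k * (2 * Real.exp (-(δ / 8 * n))) := by gcongr
        _ = _ := by ring
  have hbad₂ : freq bad₂ < 1 / 2 := by
    refine lt_of_le_of_lt ((freq_exists_le _).trans (sum_le_sum fun p _ =>
      freq_transversals_lt_le p.1 p.2 a (μ / 2 * n ^ 2))) ?_
    rw [sum_const, nsmul_eq_mul, card_univ, Fintype.card_prod, Fintype.card_fun,
      Fintype.card_fin, Fintype.card_finset]
    push_cast
    rw [← hn]
    have h2 : ((2 : ℝ) ^ Fintype.card W) ^ k ≤ Real.exp (k * n) := by
      have : (2 : ℝ) ≤ Real.exp 1 := by linarith [Real.add_one_le_exp (1 : ℝ)]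
      calc ((2 : ℝ) ^ Fintype.card W) ^ k ≤ ((Real.exp 1) ^ Fintype.card W) ^ k := by gcongr
        _ = _ := by
            rw [← Real.exp_nat_mul, ← Real.exp_nat_mul, hn]; ring_nf
    have h3 : n ≤ Real.exp n := by linarith [Real.add_one_le_exp n]
    have h5 : 2 * (k + 2) * n ≤ μ * n * n := by
      rw [div_le_iff₀ hμ] at hn₅
      nlinarith
    calc ((2 : ℝ) ^ Fintype.card W) ^ k * n * Real.exp (-(μ / 2 * n ^ 2))
        ≤ Real.exp (k * n) * Real.exp n * Real.exp (-(μ / 2 * n ^ 2)) := by gcongr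
      _ = Real.exp (k * n + n - μ / 2 * n ^ 2) := by
          rw [← Real.exp_add, ← Real.exp_add]; ring_nf
      _ ≤ Real.exp (-1) := by
          rw [Real.exp_le_exp]; nlinarith
      _ < 1 / 2 := by
          rw [Real.exp_neg, one_div]
          exact inv_strictAnti₀ (by norm_num) (by
            have := Real.add_one_lt_exp (one_ne_zero : (1 : ℝ) ≠ 0); linarith)
  obtain ⟨g, hg⟩ := exists_not_of_freq_lt_one (P := fun g => bad₁ g ∨ bad₂ g)
    (by linarith [freq_or_le bad₁ bad₂])
  push Not at hg
  obtain ⟨hg₁, hg₂⟩ := hg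
  simp only [bad₁, bad₂, not_exists, not_lt] at hg₁ hg₂
  refine ⟨g, fun X => ?_, fun S hS => ?_⟩
  · have h₁ : ∑ s, (δ * ((transversalsWithSum X s).card : ℝ) - μ / 2 * n ^ 2) ≤
        ((switchGraph k a g).edgeTuples X : ℝ) :=
      (sum_le_sum fun s _ => hg₂ (X, s)).trans (sum_ind_le_edgeTuples X a g)
    rw [sum_sub_distrib, ← mul_sum, sum_const, nsmul_eq_mul, card_univ, ← hn] at h₁
    have h₂ := prod_card_le X
    rw [← hn] at h₂ ⊢
    set Q := ∑ s, ((transversalsWithSum X s).card : ℝ)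
    have hkk : (1 : ℝ) ≤ (k : ℝ) ^ k := by
      exact_mod_cast Nat.one_le_pow _ _ (by omega)
    have hδ1 : δ / k ^ k ≤ 1 := by
      rw [div_le_one (by positivity)]
      exact (pow_le_one₀ (by norm_num) (by norm_num)).trans hkk
    have h₃ : (k : ℝ) ^ 2 / n ≤ μ / 2 := by
      rw [div_le_iff₀ hμ] at hn₃
      rw [div_le_iff₀ hn0]
      linarith
    -- The losses over all `n` sums add up to order `n ^ 3`, which the error term `μ n ^ k` admits
    -- because `k ≥ 3`.
    have h₄ : n * (μ / 2 * n ^ 2) ≤ μ / 2 * n ^ k := by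
      have : n ^ 3 ≤ n ^ k := pow_le_pow_right₀ hn₂ hk
      nlinarith
    have h₅ : δ / k ^ k * ∏ i, ((X i).card : ℝ) ≤ δ * Q + μ / 2 * n ^ k := by
      calc δ / k ^ k * ∏ i, ((X i).card : ℝ)
          ≤ δ / k ^ k * (k ^ k * Q + (k : ℝ) ^ 2 / n * n ^ k) := by gcongr
        _ = δ * Q + δ / k ^ k * ((k : ℝ) ^ 2 / n * n ^ k) := by field_simp
        _ ≤ δ * Q + 1 * (μ / 2 * n ^ k) := by gcongr
        _ = _ := by ring
    linarith
  · have := hg₁ ⟨S, hS⟩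
    linarith

/-! ### The divisibility obstruction -/

section Obstruction

variable {k : ℕ} {V W : Type*} [DecidableEq V] [Fintype W] [DecidableEq W]

/-- Choose transversals through `v` and through `w` that agree elsewhere. Both are edges with the
same remaining `(k - 1)`-set, whose colour equals both `a`-values. -/
lemma eq_of_mem_class {F : KGraph k V} {χ : V → Fin k} (hχ : Function.Surjective χ)
    (hc : ∀ e : Finset V, (∀ i, (e.filter fun v => χ v = i).card = 1) → e ∈ F.edges)
    {a : W → Bool} {g : Finset W → Bool} (c : Copy F (switchGraph k a g)) {v w : V}
    (hvw : χ v = χ w) : a (c.toEmbedding v) = a (c.toEmbedding w) := by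
  classical
  choose r hr using hχ
  let e : V → Finset V := fun v => univ.image (Function.update r (χ v) v)
  have hup : ∀ v i, χ (Function.update r (χ v) v i) = i := fun v i => by
    by_cases h : i = χ v
    · subst h; simp
    · rw [Function.update_of_ne h, hr]
  have he : ∀ v, e v ∈ F.edges := fun v => hc _ fun i => by
    rw [card_eq_one]
    refine ⟨Function.update r (χ v) v i, ?_⟩
    ext y
    simp only [e, mem_filter, mem_image, mem_univ, true_and, mem_singleton]
    constructor
    · rintro ⟨⟨j, rfl⟩, h⟩
      rw [hup] at h; rw [h]
    · rintro rfl
      exact ⟨⟨i, rfl⟩, hup _ _⟩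
  have hv : v ∈ e v := mem_image.2 ⟨χ v, mem_univ _, by simp⟩
  have hw : w ∈ e w := mem_image.2 ⟨χ w, mem_univ _, by simp⟩
  have her : ∀ v, (e v).erase v = (univ.erase (χ v)).image r := fun v => by
    ext y
    simp only [e, mem_erase, mem_image, mem_univ, true_and]
    constructor
    · rintro ⟨hy, i, rfl⟩
      have : i ≠ χ v := by rintro rfl; simp at hy
      exact ⟨i, ⟨this, trivial⟩, by rw [Function.update_of_ne this]⟩
    · rintro ⟨i, ⟨hi, -⟩, rfl⟩
      refine ⟨?_, i, by rw [Function.update_of_ne hi]⟩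
      rintro rfl
      exact hi (hr i).symm
  have hev := (mem_edges_switchGraph.1 (c.map_edges _ (he v))).2 _ (mem_map_of_mem _ hv)
  have hew := (mem_edges_switchGraph.1 (c.map_edges _ (he w))).2 _ (mem_map_of_mem _ hw)
  rw [← map_erase] at hev hew
  rw [← hev, ← hew, her, her, hvw]

/-- Each copy meets the vertices of colour `true` in a union of whole classes. -/
lemma dvd_card_of_hasFactor [Fintype V] {F : KGraph k V} {χ : V → Fin k} (hχ : Function.Surjective χ)
    (hc : ∀ e : Finset V, (∀ i, (e.filter fun v => χ v = i).card = 1) → e ∈ F.edges)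
    {q : ℕ} (hq : ∀ i, q ∣ (univ.filter fun v => χ v = i).card)
    {a : W → Bool} {g : Finset W → Bool} (hF : HasFactor F (switchGraph k a g)) :
    q ∣ (univ.filter fun w => a w = true).card := by
  classical
  obtain ⟨T, hT, hcov⟩ := hF
  have hfin : Finite (Copy F (switchGraph k a g)) :=
    Finite.of_injective Copy.toEmbedding fun c c' h => by cases c; cases c'; simp_all
  have hTfin : T.Finite := Set.toFinite _
  let part : Copy F (switchGraph k a g) → Finset W := fun c =>
    (univ.filter fun v => a (c.toEmbedding v) = true).map c.toEmbedding
  have hpart : univ.filter (fun w => a w = true) = hTfin.toFinset.biUnion part := by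
    ext w
    simp only [mem_filter, mem_univ, true_and, mem_biUnion, Set.Finite.mem_toFinset, part, Finset.mem_map]
    constructor
    · intro hw
      have : w ∈ ⋃ c ∈ T, c.verts := hcov ▸ Set.mem_univ w
      simp only [Set.mem_iUnion] at this
      obtain ⟨c, hc, v, rfl⟩ := this
      exact ⟨c, hc, v, hw, rfl⟩
    · rintro ⟨c, -, v, hv, rfl⟩
      exact hv
  rw [hpart, card_biUnion]
  · refine dvd_sum fun c _ => ?_
    rw [card_map, card_eq_sum_card_fiberwise (f := χ) (t := univ) (by simp)]
    refine dvd_sum fun i _ => ?_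
    obtain ⟨r, hr⟩ := hχ i
    by_cases h : a (c.toEmbedding r) = true
    · refine (hq i).trans (dvd_of_eq (congrArg card ?_))
      ext v
      simp only [mem_filter, mem_univ, true_and, iff_and_self]
      intro hv
      rw [← h]
      exact eq_of_mem_class hχ hc c (hv.trans hr.symm)
    · convert dvd_zero q
      rw [card_eq_zero, filter_eq_empty_iff]
      intro v hv hvi
      simp only [mem_filter, mem_univ, true_and] at hv
      exact h ((eq_of_mem_class hχ hc c (hvi.trans hr.symm)).symm.trans hv)
  · intro c hc c' hc' hne
    rw [Function.onFun, disjoint_left]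
    intro w hw hw'
    obtain ⟨v, -, rfl⟩ := Finset.mem_map.1 hw
    obtain ⟨v', -, h⟩ := Finset.mem_map.1 hw'
    exact Set.disjoint_left.1 (hT (hTfin.mem_toFinset.1 hc) (hTfin.mem_toFinset.1 hc') hne)
      ⟨v, rfl⟩ ⟨v', h⟩

end Obstruction

lemma classSizes_dvd_of_setGcd_ne_one {k : ℕ} (hk : 0 < k) {V : Type*} [Fintype V]
    [DecidableEq V] {F : KGraph k V} (hF : F.IsKPartite) (h : Nat.setGcd F.classSizes ≠ 1) :
    ∃ q, 1 < q ∧ ∀ m ∈ F.classSizes, q ∣ m := by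
  refine ⟨Nat.setGcd F.classSizes, ?_, fun m hm => Nat.setGcd_dvd_of_mem hm⟩
  obtain ⟨χ, hχ⟩ := hF
  have hmem : (univ.filter fun v => χ v = ⟨0, hk⟩).card ∈ F.classSizes := ⟨χ, hχ, _, rfl⟩
  have hpos : 0 < (univ.filter fun v => χ v = ⟨0, hk⟩).card := by
    obtain ⟨v, hv⟩ := hχ.1 ⟨0, hk⟩
    exact card_pos.2 ⟨v, by simp [hv]⟩
  have := Nat.pos_of_dvd_of_pos (Nat.setGcd_dvd_of_mem hmem) hpos
  omega

/-- A common divisor `q > 1` of the class sizes would force `q` to divide the size of a colour class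
that is chosen to be `1` modulo `q`. -/
lemma setGcd_eq_one_of_inFACTOR {k : ℕ} (hk : 3 ≤ k) {V : Type u} [Fintype V] [DecidableEq V]
    {F : KGraph k V} (hF : F.IsCompleteKPartite) (hfac : F.InFACTOR (k - 1)) :
    Nat.setGcd F.classSizes = 1 := by
  by_contra hne
  obtain ⟨χ, hχ, hc⟩ := hF
  obtain ⟨q, hq, hdvd⟩ := classSizes_dvd_of_setGcd_ne_one (by omega) ⟨χ, hχ⟩ hne
  have hqχ : ∀ i, q ∣ (univ.filter fun v => χ v = i).card := fun i =>
    hdvd _ ⟨χ, hχ, i, rfl⟩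
  have hkk : (1 : ℝ) ≤ (k : ℝ) ^ k := by exact_mod_cast Nat.one_le_pow _ _ (by omega)
  have hhalf : (1 / 2 : ℝ) ^ (k + 1) < 1 := pow_lt_one₀ (by norm_num) (by norm_num) (by omega)
  have hhalf' : (0 : ℝ) < (1 / 2 : ℝ) ^ (k + 1) := by positivity
  obtain ⟨n₀, μ, hμ, H⟩ := hfac ((1 / 2) ^ (k + 1) / k ^ k) ((1 / 2) ^ (k + 1) / 8)
    (by positivity) (by rw [div_lt_one (by positivity)]; linarith) (by positivity) (by linarith)
  obtain ⟨N, hN⟩ := exists_isDense_switchGraph.{u} hk hμ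
  have hV : 0 < Fintype.card V := by
    obtain ⟨v, -⟩ := hχ.1 ⟨0, by omega⟩
    exact Fintype.card_pos_iff.2 ⟨v⟩
  set n := Fintype.card V * (n₀ + N + 12 * q + k) with hn
  have hnle : n₀ + N + 12 * q + k ≤ n := Nat.le_mul_of_pos_left _ hV
  have : NeZero n := ⟨by omega⟩
  let W := ULift.{u} (ZMod n)
  have hW : Fintype.card W = n := by simp [W, ZMod.card]
  -- The size is `1` modulo `q` and within `q` of `n / 2`, so both colour classes have at least `n /
  -- 3` vertices.
  obtain ⟨A, hA⟩ : ∃ A : Finset W, A.card = q * (n / (2 * q)) + 1 := by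
    have h₁ : q * (n / (2 * q)) + 1 ≤ Fintype.card W := by
      rw [hW]
      have := Nat.mul_div_le n (2 * q)
      nlinarith
    obtain ⟨A, -, hA⟩ := exists_subset_card_eq (s := (univ : Finset W))
      (n := q * (n / (2 * q)) + 1) (by rwa [card_univ])
    exact ⟨A, hA⟩
  have hlow : n < 2 * (q * (n / (2 * q))) + 2 * q := by
    have := Nat.lt_mul_div_succ n (show 0 < 2 * q by omega)
    nlinarith
  have hupp : 2 * (q * (n / (2 * q))) ≤ n := by
    have := Nat.mul_div_le n (2 * q)
    nlinarith
  have hsize : ∀ c, (Fintype.card W : ℝ) / 3 ≤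
      ((univ.filter fun w : W => decide (w ∈ A) = c).card : ℝ) := by
    intro c
    rw [div_le_iff₀ (by norm_num)]
    have hcomp := card_compl A
    rw [hW, hA] at hcomp
    cases c
    · have : univ.filter (fun w : W => decide (w ∈ A) = false) = Aᶜ := by ext; simp
      rw [this, hW]
      norm_cast
      omega
    · have : univ.filter (fun w : W => decide (w ∈ A) = true) = A := by ext; simp
      rw [this, hW]
      norm_cast
      omega
  obtain ⟨g, hg₁, hg₂⟩ := hN W (fun w => decide (w ∈ A)) (by omega) hsize
  have hfactor := H W (switchGraph k (fun w => decide (w ∈ A)) g) (by omega) hg₁ ?_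
    (by rw [hW]; exact Dvd.intro _ rfl)
  · have := dvd_card_of_hasFactor hχ.1 hc hqχ hfactor
    have h' : univ.filter (fun w : W => decide (w ∈ A) = true) = A := by ext; simp
    rw [h', hA] at this
    have := (Nat.dvd_add_right (Dvd.intro _ rfl)).1 this
    exact absurd (Nat.le_of_dvd one_pos this) (by omega)
  · rw [show k - (k - 1) = 1 by omega, pow_one]
    obtain ⟨S, hS, hd⟩ : ((switchGraph k (fun w => decide (w ∈ A)) g).minDegree (k - 1)) ∈
        {d : ℕ | ∃ S : Finset W, S.card = k - 1 ∧
          d = (switchGraph k (fun w => decide (w ∈ A)) g).deg S} := by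
      -- A `(k - 1)`-set must exist, for otherwise the minimum degree would have the default value
      -- `0`.
      refine Nat.sInf_mem ?_
      obtain ⟨S, -, hS⟩ := exists_subset_card_eq (s := (univ : Finset W)) (n := k - 1)
        (by rw [card_univ, hW]; omega)
      exact ⟨_, S, hS, rfl⟩
    rw [hd]
    exact hg₂ S (by omega)

/-! ### Sets tiled by copies of F -/

section Tiled

variable {k : ℕ} {V W : Type*} [Fintype V] [DecidableEq W]

/-- `Tiled F H U`: the set `U` of vertices of `H` is a disjoint union of copies of `F`. -/
inductive Tiled (F : KGraph k V) (H : KGraph k W) : Finset W → Prop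
  | empty : Tiled F H ∅
  | cons (c : Copy F H) (U : Finset W) (h : Disjoint (univ.map c.toEmbedding) U)
      (hU : Tiled F H U) : Tiled F H (univ.map c.toEmbedding ∪ U)

variable {F : KGraph k V} {H : KGraph k W}

lemma Copy.tiled (c : Copy F H) : Tiled F H (univ.map c.toEmbedding) := by
  simpa using Tiled.cons c ∅ (disjoint_empty_right _) Tiled.empty

lemma Tiled.union {U U' : Finset W} (hU : Tiled F H U) (hU' : Tiled F H U')
    (h : Disjoint U U') : Tiled F H (U ∪ U') := by
  induction hU with
  | empty => simpa using hU'
  | cons c U hd _ ih =>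
    rw [disjoint_union_left] at h
    rw [union_assoc]
    exact Tiled.cons c _ (disjoint_union_right.2 ⟨hd, h.1⟩) (ih h.2)

lemma Tiled.biUnion {ι : Type*} [DecidableEq ι] (s : Finset ι) (U : ι → Finset W)
    (hU : ∀ i ∈ s, Tiled F H (U i)) (hd : (s : Set ι).PairwiseDisjoint U) :
    Tiled F H (s.biUnion U) := by
  induction s using Finset.induction_on with
  | empty => simpa using Tiled.empty
  | insert a s ha ih =>
    rw [biUnion_insert]
    refine (hU a (mem_insert_self _ _)).union
      (ih (fun i hi => hU i (mem_insert_of_mem hi)) (hd.subset (by simp))) ?_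
    rw [disjoint_biUnion_right]
    intro i hi
    exact hd (by simp) (by simp [hi]) (by rintro rfl; exact ha hi)

lemma Tiled.card_dvd {U : Finset W} (hU : Tiled F H U) : Fintype.card V ∣ U.card := by
  induction hU with
  | empty => simp
  | cons c U hd _ ih =>
    rw [card_union_of_disjoint hd, card_map, card_univ]
    exact (Nat.dvd_add_right dvd_rfl).2 ih

lemma Tiled.exists_copies {U : Finset W} (hU : Tiled F H U) :
    ∃ T : Set (Copy F H), T.PairwiseDisjoint Copy.verts ∧ ⋃ c ∈ T, c.verts = (U : Set W) := by
  induction hU with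
  | empty => exact ⟨∅, by simp, by simp⟩
  | cons c U hd _ ih =>
    obtain ⟨T, hT, hTU⟩ := ih
    have hc : c.verts = ((univ.map c.toEmbedding : Finset W) : Set W) := by
      simp [Copy.verts]
    refine ⟨insert c T, hT.insert fun c' hc' _ => ?_, ?_⟩
    · have : c'.verts ⊆ (U : Set W) := hTU ▸ Set.subset_biUnion_of_mem (u := Copy.verts) hc'
      rw [hc]
      exact (disjoint_coe.2 hd).mono_right this
    · rw [Set.biUnion_insert, hTU, coe_union, hc]

lemma Tiled.hasFactor [Fintype W] (h : Tiled F H univ) : HasFactor F H := by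
  unfold HasFactor
  simpa using h.exists_copies

end Tiled

/-! ### The lattice of index vectors -/

section Lattice

variable {k : ℕ} {V : Type*} [Fintype V] [DecidableEq V]

/-- A `k`-partite realisation of `F` with a label for each of its classes. -/
def LabelledRealisation (F : KGraph k V) : Type _ :=
  {p : (V → Fin k) × (Fin k → V) // F.IsRealisation p.1}

/-- The number of vertices with each label. -/
def LabelledRealisation.index {F : KGraph k V} (R : LabelledRealisation F) (i : V) : ℤ :=
  ((univ.filter fun v => R.1.2 (R.1.1 v) = i).card : ℤ)

/-- Negative terms of an integer combination are moved to the other side. -/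
lemma LabelledRealisation.exists_lists {F : KGraph k V} {x : V → ℤ}
    (hx : x ∈ AddSubgroup.closure (Set.range (LabelledRealisation.index (F := F)))) :
    ∃ A B : List (LabelledRealisation F),
      x + (A.map LabelledRealisation.index).sum = (B.map LabelledRealisation.index).sum := by
  induction hx using AddSubgroup.closure_induction with
  | mem x hx =>
    obtain ⟨R, rfl⟩ := hx
    exact ⟨[], [R], by simp⟩
  | zero => exact ⟨[], [], by simp⟩
  | add x y _ _ hx hy =>
    obtain ⟨A, B, h⟩ := hx
    obtain ⟨A', B', h'⟩ := hy
    refine ⟨A ++ A', B ++ B', ?_⟩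
    rw [List.map_append, List.map_append, List.sum_append, List.sum_append, ← h, ← h']
    abel
  | neg x _ hx =>
    obtain ⟨A, B, h⟩ := hx
    exact ⟨B, A, by rw [← h]; abel⟩

/-- The integers `m` with `m • x ∈ K` form a subgroup of `ℤ`; its generator divides every element of
`s`, hence `1`. -/
lemma mem_of_setGcd_eq_one {G : Type*} [AddCommGroup G] (K : AddSubgroup G) (x : G) (s : Set ℕ)
    (hs : Nat.setGcd s = 1) (h : ∀ m ∈ s, (m : ℤ) • x ∈ K) : x ∈ K := by
  obtain ⟨d, hd⟩ := Int.subgroup_cyclic (K.comap (zmultiplesHom G x))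
  have h₁ : d.natAbs ∣ Nat.setGcd s := by
    rw [Nat.dvd_setGcd_iff]
    intro m hm
    have : (m : ℤ) ∈ K.comap (zmultiplesHom G x) := h m hm
    rw [hd, ← AddSubgroup.zmultiples_eq_closure, Int.mem_zmultiples_iff] at this
    exact Int.natAbs_dvd_natAbs.2 this
  rw [hs, Nat.dvd_one] at h₁
  have : (1 : ℤ) ∈ K.comap (zmultiplesHom G x) := by
    rw [hd, ← AddSubgroup.zmultiples_eq_closure, Int.mem_zmultiples_iff]
    exact Int.natAbs_dvd.1 (by rw [h₁]; simp)
  simpa using this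

/-- Labelling one class by `j` and the others by `r`, rather than all by `r`, changes the index by
`m • (e_j - e_r)`, where `m` is the class size. As the sizes are coprime, every `e_j - e_r` is in
the lattice. These sum to the all-ones vector minus `v(F) • e_r`, and `v(F) • e_r` is the index of
the constant labelling. -/
lemma one_mem_closure_index {F : KGraph k V} (hF : F.IsKPartite)
    (hgcd : Nat.setGcd F.classSizes = 1) :
    (1 : V → ℤ) ∈ AddSubgroup.closure (Set.range (LabelledRealisation.index (F := F))) := by
  set K := AddSubgroup.closure (Set.range (LabelledRealisation.index (F := F)))
  rcases isEmpty_or_nonempty V with hV | ⟨⟨r⟩⟩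
  · rw [Subsingleton.elim (1 : V → ℤ) 0]; exact K.zero_mem
  have hmem : ∀ R : LabelledRealisation F, R.index ∈ K := fun R =>
    AddSubgroup.subset_closure ⟨R, rfl⟩
  have h₁ : (Fintype.card V : ℤ) • Pi.single r (1 : ℤ) ∈ K := by
    obtain ⟨χ, hχ⟩ := hF
    convert hmem ⟨(χ, fun _ => r), hχ⟩ using 1
    funext i
    by_cases h : i = r
    · subst h; simp [LabelledRealisation.index]
    · simp [LabelledRealisation.index, h, Ne.symm h]
  have h₂ : ∀ j : V, Pi.single j (1 : ℤ) - Pi.single r 1 ∈ K := fun j => by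
    refine mem_of_setGcd_eq_one K _ _ hgcd ?_
    rintro m ⟨χ, hχ, c, rfl⟩
    by_cases hjr : j = r
    · subst hjr; simp
    have := K.sub_mem (hmem ⟨(χ, fun c' => if c' = c then j else r), hχ⟩) h₁
    convert this using 1
    funext i
    have hcard := card_filter_add_card_filter_not (s := (univ : Finset V)) (fun v => χ v = c)
    rw [card_univ] at hcard
    by_cases hij : i = j
    · subst hij
      simp [LabelledRealisation.index, hjr, Ne.symm hjr]
    by_cases hir : i = r
    · subst hir
      simp [LabelledRealisation.index, hij, Ne.symm hij, ← hcard]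
    · simp [LabelledRealisation.index, hij, hir, ite_eq_iff, Ne.symm hij, Ne.symm hir]
  have h₃ : (1 : V → ℤ) = ∑ j : V, (Pi.single j (1 : ℤ) - Pi.single r 1) +
      (Fintype.card V : ℤ) • Pi.single r (1 : ℤ) := by
    rw [sum_sub_distrib, sum_const, card_univ]
    have : ∑ j : V, Pi.single j (1 : ℤ) = (1 : V → ℤ) := by
      funext i; simp [Finset.sum_apply, Pi.single_apply]
    rw [this]
    simp
  rw [h₃]
  exact K.add_mem (K.sum_mem fun j _ => h₂ j) h₁

/-- There are two families of labelled realisations of `F` such that the second one covers each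
label exactly once more often than the first one. -/
lemma exists_label_equiv {F : KGraph k V} (hF : F.IsKPartite)
    (hgcd : Nat.setGcd F.classSizes = 1) :
    ∃ (a b : ℕ) (A : Fin a → LabelledRealisation F) (B : Fin b → LabelledRealisation F)
      (e : Fin b × V ≃ (Fin a × V) ⊕ V),
      ∀ p, Sum.elim (fun q : Fin a × V => (A q.1).1.2 ((A q.1).1.1 q.2)) id (e p) =
        (B p.1).1.2 ((B p.1).1.1 p.2) := by
  obtain ⟨A, B, h⟩ := LabelledRealisation.exists_lists (one_mem_closure_index hF hgcd)
  let f : Fin B.length × V → V := fun p => (B.get p.1).1.2 ((B.get p.1).1.1 p.2)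
  let g₀ : Fin A.length × V → V := fun q => (A.get q.1).1.2 ((A.get q.1).1.1 q.2)
  let g : (Fin A.length × V) ⊕ V → V := Sum.elim g₀ id
  have hsum : ∀ (L : List (LabelledRealisation F)) (i : V),
      (L.map LabelledRealisation.index).sum i =
        (Fintype.card {p : Fin L.length × V // (L.get p.1).1.2 ((L.get p.1).1.1 p.2) = i} : ℤ) := by
    intro L i
    rw [Fintype.card_subtype, ← univ_product_univ, card_filter, sum_product,
      ← Fin.sum_univ_getElem, Finset.sum_apply]
    push_cast
    rw [← Equiv.sum_comp (finCongr (L.length_map (f := LabelledRealisation.index)).symm)]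
    refine sum_congr rfl fun j _ => ?_
    rw [sum_boole]
    refine (congrFun (List.getElem_map LabelledRealisation.index) i).trans ?_
    simp [LabelledRealisation.index]
  -- Equal numbers of positions with each label suffice for a label-preserving bijection.
  have hcard : ∀ i, Fintype.card {p // f p = i} = Fintype.card {q // g q = i} := by
    intro i
    have hi := congrFun h i
    rw [Pi.add_apply, hsum, hsum, Pi.one_apply] at hi
    have hg : Fintype.card {q // g q = i} = Fintype.card {q // g₀ q = i} + 1 := by
      rw [Fintype.card_congr (Equiv.subtypeSum (p := fun q => g q = i)), Fintype.card_sum]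
      exact congrArg _ (Fintype.card_eq_one_iff.2 ⟨⟨i, rfl⟩, fun ⟨_, hb⟩ => Subtype.ext hb⟩)
    rw [hg]
    have : (1 : ℤ) + (Fintype.card {q // g₀ q = i} : ℤ) = (Fintype.card {p // f p = i} : ℤ) := hi
    omega
  refine ⟨A.length, B.length, A.get, B.get,
    Equiv.ofFiberEquiv (f := f) (g := g) fun i => Fintype.equivOfCardEq (hcard i), fun p => ?_⟩
  exact Equiv.ofFiberEquiv_map _ p

end Lattice

/-! ### Absorbing sets from many absorbers -/

section Absorption

variable {k : ℕ} {V W ι : Type*} [Fintype V] [DecidableEq W] [Fintype ι]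

/-- The tuple `τ` absorbs the tuple `s`: its set of vertices has an `F`-factor both with and
without the vertices of `s`. -/
structure Absorbs (F : KGraph k V) (H : KGraph k W) (s : V → W) (τ : ι → W) : Prop where
  ne : ∀ i v, τ i ≠ s v
  tiled : Tiled F H (univ.image τ)
  tiled_union : Tiled F H (univ.image τ ∪ univ.image s)

variable {F : KGraph k V} {H : KGraph k W}

-- `L` is split into pieces of `v(F)` vertices, and each piece uses up one absorber. As every `s`
-- has at least `m` absorbers, one is always left; the unused ones are tiled on their own.
open Classical in
lemma tiled_biUnion_union {σ : Type*} [DecidableEq σ] (T : σ → ι → W) (m : ℕ) :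
    ∀ (J : Finset σ),
    (∀ i ∈ J, ∀ j ∈ J, i ≠ j → Disjoint (univ.image (T i)) (univ.image (T j))) →
    (∀ i ∈ J, Tiled F H (univ.image (T i))) →
    (∀ s : V → W, Function.Injective s → m ≤ (J.filter fun i => Absorbs F H s (T i)).card) →
    ∀ L : Finset W, Disjoint (J.biUnion fun i => univ.image (T i)) L →
      L.card = Fintype.card V * m →
      Tiled F H ((J.biUnion fun i => univ.image (T i)) ∪ L) := by
  induction m with
  | zero =>
    intro J hJ hT _ L _ hL
    rw [mul_zero, card_eq_zero] at hL
    rw [hL, union_empty]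
    exact Tiled.biUnion J _ hT fun i hi j hj hij => hJ i hi j hj hij
  | succ m ih =>
    intro J hJ hT hs L hJL hL
    obtain ⟨S, hSL, hS⟩ := exists_subset_card_eq (s := L) (n := Fintype.card V)
      (by rw [hL]; exact Nat.le_mul_of_pos_right _ (Nat.succ_pos m))
    have hcard : Fintype.card V = Fintype.card S := by rw [Fintype.card_coe, hS]
    let φ : V ≃ S := Fintype.equivOfCardEq hcard
    let s : V → W := fun v => φ v
    have hsinj : Function.Injective s := Subtype.val_injective.comp φ.injective
    have hsS : univ.image s = S := by
      ext w
      simp only [mem_image, mem_univ, true_and, s]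
      exact ⟨by rintro ⟨v, rfl⟩; exact (φ v).2, fun hw => ⟨φ.symm ⟨w, hw⟩, by simp⟩⟩
    obtain ⟨i, hi⟩ := card_pos.1 (lt_of_lt_of_le (Nat.succ_pos m) (hs s hsinj))
    obtain ⟨hiJ, hiA⟩ := mem_filter.1 hi
    have hdec : (J.biUnion fun i => univ.image (T i)) ∪ L =
        (univ.image (T i) ∪ univ.image s) ∪
          (((J.erase i).biUnion fun i => univ.image (T i)) ∪ (L \ S)) := by
      rw [hsS]
      nth_rewrite 1 [← insert_erase hiJ]
      nth_rewrite 1 [← union_sdiff_of_subset hSL]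
      rw [biUnion_insert]
      ext w
      simp only [mem_union]
      tauto
    have hJi : Disjoint (univ.image (T i)) ((J.erase i).biUnion fun i => univ.image (T i)) := by
      rw [disjoint_biUnion_right]
      intro j hj
      exact hJ i hiJ j (mem_of_mem_erase hj) (ne_of_mem_erase hj).symm
    have hiL : Disjoint (univ.image (T i)) L :=
      hJL.mono_left (subset_biUnion_of_mem (fun i => univ.image (T i)) hiJ)
    have heL : Disjoint ((J.erase i).biUnion fun i => univ.image (T i)) L :=
      hJL.mono_left (biUnion_subset_biUnion_of_subset_left _ (erase_subset _ _))
    rw [hdec]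
    refine hiA.tiled_union.union (ih (J.erase i) ?_ ?_ ?_ (L \ S) ?_ ?_) ?_
    · exact fun a ha b hb => hJ a (mem_of_mem_erase ha) b (mem_of_mem_erase hb)
    · exact fun a ha => hT a (mem_of_mem_erase ha)
    · intro s' hs'
      have h₁ := hs s' hs'
      have h₂ : (J.filter fun i => Absorbs F H s' (T i)) ⊆
          insert i ((J.erase i).filter fun i => Absorbs F H s' (T i)) := by
        intro j hj
        rw [mem_filter] at hj
        by_cases hji : j = i
        · exact mem_insert.2 (Or.inl hji)
        · exact mem_insert_of_mem (mem_filter.2 ⟨mem_erase.2 ⟨hji, hj.1⟩, hj.2⟩)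
      have h₃ := (card_le_card h₂).trans (card_insert_le _ _)
      omega
    · exact heL.mono_right sdiff_subset
    · rw [card_sdiff_of_subset hSL, hL, hS, Nat.mul_succ, Nat.add_sub_cancel]
    · rw [hsS, disjoint_union_left, disjoint_union_right, disjoint_union_right]
      exact ⟨⟨hJi, hiL.mono_right sdiff_subset⟩, (heL.mono_right hSL).symm, disjoint_sdiff⟩

/-- The `M` choices are independent, so the exponential moment is a product. -/
lemma expect_exp_neg_sum_le {α : Type*} [Fintype α] (P : α → Prop) {β : ℝ} (hβ : β ≤ freq P)
    (M : ℕ) [Nonempty α] :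
    𝔼 T : Fin M → α, Real.exp (-∑ i, ind (P (T i))) ≤ Real.exp (-(β / 2 * M)) := by
  have hP := freq_nonneg P
  have hc := half_le_one_sub_exp_neg_one
  calc 𝔼 T : Fin M → α, Real.exp (-∑ i, ind (P (T i)))
      = 𝔼 T : Fin M → α, ∏ i, Real.exp (-ind (P (T i))) := by
        simp only [← sum_neg_distrib, Real.exp_sum]
    _ = (𝔼 x, Real.exp (-ind (P x))) ^ M := by
        rw [expect_prod_eval fun (_ : Fin M) x => Real.exp (-ind (P x))]; simp
    _ ≤ (Real.exp (-(β / 2))) ^ M := by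
        refine pow_le_pow_left₀ (expect_nonneg fun _ _ => (Real.exp_pos _).le) ?_ M
        simp only [exp_neg_ind]
        rw [expect_sub_distrib, ← mul_expect, expect_const univ_nonempty]
        change 1 - (1 - Real.exp (-1)) * freq P ≤ _
        nlinarith [Real.add_one_le_exp (-(β / 2))]
    _ = _ := by rw [← Real.exp_nat_mul]; ring_nf

lemma freq_meet_le {W : Type*} [Fintype W] [Nonempty W] [DecidableEq ι] :
    freq (fun x : (ι → W) × (ι → W) => ∃ a b, x.1 a = x.2 b) ≤
      (Fintype.card ι : ℝ) ^ 2 / Fintype.card W := by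
  calc freq (fun x : (ι → W) × (ι → W) => ∃ a b, x.1 a = x.2 b)
      ≤ freq (fun x : (ι → W) × (ι → W) => ∃ p : ι × ι, x.1 p.1 = x.2 p.2) :=
        freq_mono fun x ⟨a, b, h⟩ => ⟨(a, b), h⟩
    _ ≤ ∑ p : ι × ι, freq (fun x : (ι → W) × (ι → W) => x.1 p.1 = x.2 p.2) := freq_exists_le _
    _ = ∑ p : ι × ι, 1 / (Fintype.card W : ℝ) := by
        refine sum_congr rfl fun p _ => ?_
        rw [freq_prod_type]
        have : ∀ a : ι → W, freq (fun b : ι → W => a p.1 = b p.2) = 1 / Fintype.card W :=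
          fun a => by
            rw [← freq_eval_eq p.2 (a p.1)]
            exact freq_congr fun _ => eq_comm
        simp only [this]
        exact expect_const univ_nonempty _
    _ = _ := by
        simp only [sum_const, card_univ, Fintype.card_prod, nsmul_eq_mul]
        push_cast; ring

lemma freq_lt_mul_le {α : Type*} [Fintype α] (f : α → ℝ) (hf : ∀ x, 0 ≤ f x) (c : ℝ) :
    c * freq (fun x => c < f x) ≤ 𝔼 x, f x := by
  unfold freq
  rw [mul_expect]
  refine expect_le_expect fun x _ => ?_
  by_cases h : c < f x
  · rw [ind_of h, mul_one]; exact h.le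
  · rw [ind_of_not h, mul_zero]; exact hf x

open Classical in
/-- A random choice of `M` tuples contains many absorbers for every `s`, few of which meet. -/
lemma exists_tuples [Fintype W] [Nonempty W] [DecidableEq ι] {β : ℝ} (M : ℕ) (hM : 0 < M)
    (habs : ∀ s : V → W, Function.Injective s → β ≤ freq fun τ : ι → W => Absorbs F H s τ)
    (hn : (Fintype.card W : ℝ) ^ Fintype.card V * Real.exp (-(β / 4 * M)) < 3 / 4) :
    ∃ T : Fin M → ι → W,
      (∀ s : V → W, Function.Injective s →
        β / 4 * M ≤ ((univ.filter fun i => Absorbs F H s (T i)).card : ℝ)) ∧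
      ∑ i, ∑ j, ind (i ≠ j ∧ ∃ a b, T i a = T j b) ≤
        4 * ((M : ℝ) ^ 2 * ((Fintype.card ι : ℝ) + 1) ^ 2 / Fintype.card W) := by
  have hW : (0 : ℝ) < Fintype.card W := by exact_mod_cast Fintype.card_pos
  -- `E` bounds the expected number of ordered pairs of tuples that meet. The `+ 1` makes it
  -- positive even for empty `ι`, so that Markov's inequality can be divided by it.
  set E : ℝ := (M : ℝ) ^ 2 * ((Fintype.card ι : ℝ) + 1) ^ 2 / Fintype.card W with hE
  have hE0 : 0 < E := by positivity
  let bad₁ : (Fin M → ι → W) → Prop := fun T => ∃ s : V → W, Function.Injective s ∧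
    ∑ i, ind (Absorbs F H s (T i)) < β / 2 * M - β / 4 * M
  let bad₂ : (Fin M → ι → W) → Prop := fun T =>
    4 * E < ∑ i, ∑ j, ind (i ≠ j ∧ ∃ a b, T i a = T j b)
  have h₁ : freq bad₁ < 3 / 4 := by
    refine lt_of_le_of_lt ((freq_exists_le _).trans (sum_le_sum (g := fun _ =>
      Real.exp (-(β / 4 * M))) fun s _ => ?_)) ?_
    · by_cases hs : Function.Injective s
      · refine (freq_mono fun T hT => hT.2).trans (freq_lt_sub_le_exp _ _ _ ?_)
        exact expect_exp_neg_sum_le _ (habs s hs) M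
      · refine le_trans (le_of_eq ?_) (Real.exp_pos _).le
        exact expect_eq_zero fun x _ => ind_of_not fun h => hs h.1
    · rw [sum_const, nsmul_eq_mul, card_univ, Fintype.card_fun]
      push_cast
      exact hn
  have h₂ : freq bad₂ ≤ 1 / 4 := by
    have hle : 𝔼 T : Fin M → ι → W, ∑ i, ∑ j, ind (i ≠ j ∧ ∃ a b, T i a = T j b) ≤ E := by
      rw [expect_sum_comm]
      simp only [expect_sum_comm]
      calc _ ≤ ∑ i : Fin M, ∑ j : Fin M,
            (Fintype.card ι : ℝ) ^ 2 / Fintype.card W := by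
            refine sum_le_sum fun i _ => sum_le_sum fun j _ => ?_
            by_cases hij : i = j
            · refine le_trans (le_of_eq ?_) (by positivity : (0 : ℝ) ≤ _)
              exact expect_eq_zero fun x _ => ind_of_not (by simp [hij])
            · refine (freq_mono fun T hT => hT.2).trans ?_
              rw [freq_eval_pair (X := ι → W) hij fun x y => ∃ a b, x a = y b]
              exact freq_meet_le
        _ = (M : ℝ) ^ 2 * (Fintype.card ι : ℝ) ^ 2 / Fintype.card W := by
            simp; ring
        _ ≤ E := by
            rw [hE]; gcongr; linarith
    have := freq_lt_mul_le (fun T : Fin M → ι → W =>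
      ∑ i, ∑ j, ind (i ≠ j ∧ ∃ a b, T i a = T j b))
      (fun T => sum_nonneg fun _ _ => sum_nonneg fun _ _ => ind_nonneg _) (4 * E)
    have h3 : 4 * E * freq bad₂ ≤ E := this.trans hle
    by_contra! hcon
    nlinarith
  obtain ⟨T, hT⟩ := exists_not_of_freq_lt_one (P := fun T => bad₁ T ∨ bad₂ T)
    (by linarith [freq_or_le bad₁ bad₂])
  push Not at hT
  obtain ⟨hT₁, hT₂⟩ := hT
  refine ⟨T, fun s hs => ?_, not_lt.1 hT₂⟩
  by_contra! hlt
  refine hT₁ ⟨s, hs, ?_⟩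
  rw [sum_ind]
  linarith

-- Tuples that meet another one, or that are not tiled, are discarded from the random choice. By
-- `hMn` at most `βM/8` of them meet another, so at least `βM/8` of the `βM/4` absorbers of each `s`
-- survive; an absorber is tiled by definition.
open Classical in
lemma exists_absorbing_set [Fintype W] [Nonempty W] [DecidableEq ι] {β : ℝ} (M : ℕ) (hM : 0 < M)
    (habs : ∀ s : V → W, Function.Injective s → β ≤ freq fun τ : ι → W => Absorbs F H s τ)
    (hn : (Fintype.card W : ℝ) ^ Fintype.card V * Real.exp (-(β / 4 * M)) < 3 / 4)
    (hMn : (M : ℝ) * (32 * ((Fintype.card ι : ℝ) + 1) ^ 2) ≤ β * Fintype.card W) :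
    ∃ A : Finset W, A.card ≤ Fintype.card ι * M ∧
      ∀ (m : ℕ) (L : Finset W), Disjoint A L → L.card = Fintype.card V * m →
        (m : ℝ) ≤ β / 8 * M → Tiled F H (A ∪ L) := by
  obtain ⟨T, hT₁, hT₂⟩ := exists_tuples M hM habs hn
  have hW : (0 : ℝ) < Fintype.card W := by exact_mod_cast Fintype.card_pos
  let I : Finset (Fin M) := univ.filter fun i => ∀ j, i ≠ j → ∀ a b, T i a ≠ T j b
  let J : Finset (Fin M) := I.filter fun i => Tiled F H (univ.image (T i))
  have hI : ((univ.filter fun i => i ∉ I).card : ℝ) ≤ β / 8 * M := by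
    calc ((univ.filter fun i => i ∉ I).card : ℝ) = ∑ i, ind (i ∉ I) := (sum_ind _ _).symm
      _ ≤ ∑ i, ∑ j, ind (i ≠ j ∧ ∃ a b, T i a = T j b) := by
          refine sum_le_sum fun i _ => ?_
          by_cases hi : i ∈ I
          · rw [ind_of_not (by simpa using hi)]
            exact sum_nonneg fun _ _ => ind_nonneg _
          · have h := hi
            simp only [I, mem_filter, mem_univ, true_and] at h
            push Not at h
            obtain ⟨j, hij, a, b, hab⟩ := h
            rw [ind_of hi, ← ind_of (show i ≠ j ∧ ∃ a b, T i a = T j b from ⟨hij, a, b, hab⟩)]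
            exact single_le_sum (f := fun j => ind (i ≠ j ∧ ∃ a b, T i a = T j b))
              (fun _ _ => ind_nonneg _) (mem_univ j)
      _ ≤ _ := hT₂
      _ ≤ β / 8 * M := by
          rw [← mul_div_assoc, div_le_iff₀ hW]
          have : (0 : ℝ) ≤ M := by positivity
          nlinarith
  refine ⟨J.biUnion fun i => univ.image (T i), ?_, fun m L hL hcard hm => ?_⟩
  · calc _ ≤ ∑ i ∈ J, (univ.image (T i)).card := card_biUnion_le
      _ ≤ ∑ i ∈ J, Fintype.card ι := sum_le_sum fun i _ => card_image_le
      _ ≤ ∑ i : Fin M, Fintype.card ι := sum_le_sum_of_subset (subset_univ _)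
      _ = _ := by simp [mul_comm]
  · refine tiled_biUnion_union T m J ?_ ?_ ?_ L hL hcard
    · intro i hi j hj hij
      have := (mem_filter.1 (mem_filter.1 hi).1).2 j hij
      rw [disjoint_left]
      intro w hw hw'
      obtain ⟨a, -, rfl⟩ := mem_image.1 hw
      obtain ⟨b, -, h⟩ := mem_image.1 hw'
      exact this a b h.symm
    · exact fun i hi => (mem_filter.1 hi).2
    · intro s hs
      have hsub : (univ.filter fun i => Absorbs F H s (T i)) ⊆
          (J.filter fun i => Absorbs F H s (T i)) ∪ univ.filter fun i => i ∉ I := by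
        intro i hi
        have hiA := (mem_filter.1 hi).2
        by_cases hiI : i ∈ I
        · exact mem_union_left _ (mem_filter.2 ⟨mem_filter.2 ⟨hiI, hiA.tiled⟩, hiA⟩)
        · exact mem_union_right _ (mem_filter.2 ⟨mem_univ _, hiI⟩)
      have h₁ := (card_le_card hsub).trans (card_union_le _ _)
      have h₂ : ((univ.filter fun i => Absorbs F H s (T i)).card : ℝ) ≤
          ((J.filter fun i => Absorbs F H s (T i)).card : ℝ) +
            ((univ.filter fun i => i ∉ I).card : ℝ) := by exact_mod_cast h₁
      have h₃ := hT₁ s hs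
      have : (m : ℝ) ≤ ((J.filter fun i => Absorbs F H s (T i)).card : ℝ) := by linarith
      exact_mod_cast this

end Absorption

/-! ### Links, codegrees and clusters -/

section Adjacency

variable {k : ℕ} {W : Type*} [DecidableEq W]

/-- The entries of the tuple `x` form an edge. -/
def Adj (H : KGraph k W) (x : Fin k → W) : Prop := univ.image x ∈ H.edges

lemma Adj.injective {H : KGraph k W} {x : Fin k → W} (h : H.Adj x) : Function.Injective x := by
  have : (univ.image x).card = (univ : Finset (Fin k)).card := by
    rw [H.uniform _ h, card_univ, Fintype.card_fin]
  simpa using card_image_iff.1 this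

variable [Fintype W]

/-- Every `(k - 1)`-set of vertices has degree at least `α n`. -/
def CodegreeAtLeast (H : KGraph k W) (α : ℝ) : Prop :=
  ∀ S : Finset W, S.card + 1 = k → α * Fintype.card W ≤ (H.deg S : ℝ)

variable {H : KGraph k W} {α : ℝ}

lemma CodegreeAtLeast.le_freq [Nonempty W] (hH : H.CodegreeAtLeast α) (i : Fin k) (x : Fin k → W)
    (hx : Set.InjOn x {i}ᶜ) : α ≤ freq fun w => H.Adj (Function.update x i w) := by
  classical
  set S := (univ.erase i).image x with hS
  have hScard : S.card + 1 = k := by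
    have hk := i.pos
    rw [hS, card_image_of_injOn (hx.mono fun j hj => by simpa using hj), card_erase_of_mem (mem_univ i), card_univ,
      Fintype.card_fin]
    omega
  have himg : ∀ w, univ.image (Function.update x i w) = insert w S := by
    intro w
    rw [← insert_erase (mem_univ i), image_insert, Function.update_self, hS]
    congr 1
    refine image_congr fun j hj => ?_
    rw [Function.update_of_ne (by simpa using hj)]
  have hdeg : H.deg S ≤ (univ.filter fun w => H.Adj (Function.update x i w)).card := by
    refine le_trans (card_le_card ?_) (card_image_le (f := fun w => insert w S))
    intro e he
    obtain ⟨heH, hSe⟩ := mem_filter.1 he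
    have hek := H.uniform e heH
    obtain ⟨w, hwe, hwS⟩ := exists_mem_notMem_of_card_lt_card (s := S) (t := e) (by omega)
    have heq : insert w S = e := eq_of_subset_of_card_le (insert_subset hwe hSe) (by
      rw [card_insert_of_notMem hwS]; omega)
    refine mem_image.2 ⟨w, mem_filter.2 ⟨mem_univ _, ?_⟩, heq⟩
    change univ.image _ ∈ H.edges
    rwa [himg, heq]
  have hn : (0 : ℝ) < Fintype.card W := by exact_mod_cast Fintype.card_pos
  rw [freq_eq_card, le_div_iff₀ hn]
  exact (hH S hScard).trans (by exact_mod_cast hdeg)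

/-- Another coordinate `j` is resampled: whenever the tuple with `u` in position `i` is injective,
which happens at least half the time, a proportion `α` of the values at `j` gives an edge. -/
lemma CodegreeAtLeast.le_freq_link [Nonempty W] (hH : H.CodegreeAtLeast α) (hα : 0 ≤ α)
    (hk : 2 ≤ k) (hn : 4 * (k : ℝ) ^ 2 ≤ Fintype.card W) (i : Fin k) (u : W) :
    α / 2 ≤ freq fun x : Fin k → W => H.Adj (Function.update x i u) := by
  have hn0 : (0 : ℝ) < Fintype.card W := by exact_mod_cast Fintype.card_pos
  have hk' : (2 : ℝ) ≤ k := by exact_mod_cast hk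
  have : Nontrivial (Fin k) := Fin.nontrivial_iff_two_le.2 hk
  obtain ⟨j, hj⟩ := exists_ne i
  have hbad : freq (fun x : Fin k → W => ¬Function.Injective (Function.update x i u)) ≤ 1 / 2 := by
    calc freq (fun x : Fin k → W => ¬Function.Injective (Function.update x i u))
        ≤ freq (fun x : Fin k → W => ¬Function.Injective x) +
            freq (fun x : Fin k → W => ∃ l, x l = u) := by
          refine freq_le_add fun x hx => ?_
          by_contra! hcon
          obtain ⟨h₁, h₂⟩ := hcon
          refine hx fun a b hab => ?_
          by_cases ha : a = i <;> by_cases hb : b = i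
          · rw [ha, hb]
          · subst ha; rw [Function.update_self, Function.update_of_ne hb] at hab
            exact absurd hab.symm (h₂ b)
          · subst hb; rw [Function.update_self, Function.update_of_ne ha] at hab
            exact absurd hab (h₂ a)
          · rw [Function.update_of_ne ha, Function.update_of_ne hb] at hab
            exact h₁ hab
      _ ≤ (k : ℝ) ^ 2 / Fintype.card W + k * (1 / Fintype.card W) := by
          refine add_le_add (by simpa using freq_not_injective_le (ι := Fin k) (X := W)) ?_
          refine (freq_exists_le _).trans (le_of_eq ?_)
          simp [freq_eval_eq]
      _ ≤ 1 / 2 := by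
          rw [mul_one_div, ← add_div, div_le_iff₀ hn0]
          nlinarith
  have hgood : 1 / 2 ≤ freq fun x : Fin k → W => Function.Injective (Function.update x i u) := by
    have h := freq_or_le (fun x : Fin k → W => Function.Injective (Function.update x i u))
      (fun x : Fin k → W => ¬Function.Injective (Function.update x i u))
    simp only [em, freq_const_mem, ind_of] at h
    linarith
  calc α / 2 ≤ 𝔼 x : Fin k → W, α * ind (Function.Injective (Function.update x i u)) := by
        rw [← mul_expect]
        change α / 2 ≤ α * freq _
        nlinarith
    _ ≤ 𝔼 x : Fin k → W, 𝔼 w, ind (H.Adj (Function.update (Function.update x j w) i u)) := by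
        refine expect_le_expect fun x _ => ?_
        by_cases hx : Function.Injective (Function.update x i u)
        · rw [ind_of hx, mul_one]
          simp only [Function.update_comm hj]
          exact hH.le_freq j _ hx.injOn
        · rw [ind_of_not hx, mul_zero]
          exact expect_nonneg fun _ _ => ind_nonneg _
    _ = _ := expect_update j fun x => ind (H.Adj (Function.update x i u))

/-- The condition on `u` and `v` ignores the coordinate `i`, which can therefore be resampled to
make `x` itself an edge. This third edge supplies the other vertices of the class of `r` in the
gadgets. -/
lemma CodegreeAtLeast.mul_freq_le [Nonempty W] (hH : H.CodegreeAtLeast α) (i : Fin k) (u v : W) :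
    α * freq (fun x : Fin k → W => H.Adj (Function.update x i u) ∧ H.Adj (Function.update x i v)) ≤
      freq fun x : Fin k → W =>
        H.Adj x ∧ H.Adj (Function.update x i u) ∧ H.Adj (Function.update x i v) := by
  unfold freq
  rw [mul_expect, ← expect_update i fun x => ind (H.Adj x ∧ H.Adj (Function.update x i u) ∧
    H.Adj (Function.update x i v))]
  refine expect_le_expect fun x _ => ?_
  simp only [Function.update_idem]
  by_cases hx : H.Adj (Function.update x i u) ∧ H.Adj (Function.update x i v)
  · rw [ind_of hx, mul_one]
    simp only [hx.1, hx.2, and_true]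
    refine hH.le_freq i x fun a ha b hb hab => hx.1.injective ?_
    rwa [Function.update_of_ne (by simpa using ha), Function.update_of_ne (by simpa using hb)]
  · rw [ind_of_not hx, mul_zero]
    exact expect_nonneg fun _ _ => ind_nonneg _

/-- The common link of `u` and `v` has density less than `c`. -/
def FarApart (H : KGraph k W) (i : Fin k) (c : ℝ) (u v : W) : Prop :=
  freq (fun x : Fin k → W => H.Adj (Function.update x i u) ∧ H.Adj (Function.update x i v)) < c

/-- Every vertex `u` is associated with a large set of vertices almost all of which are not far
apart from `u` and from each other. -/
lemma CodegreeAtLeast.exists_cluster [Nonempty W] (hH : H.CodegreeAtLeast α) (hα : 0 < α)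
    (hk : 2 ≤ k) (hn : 4 * (k : ℝ) ^ 2 ≤ Fintype.card W) (i : Fin k) {c : ℝ} (hc : 0 < c) (u : W) :
    ∃ U : Finset W, α * Fintype.card W ≤ U.card ∧
      freq (fun p => p ∈ U ∧ H.FarApart i c p u) ≤ 5 * c / α ∧
      freq (fun q : W × W => q.1 ∈ U ∧ q.2 ∈ U ∧ H.FarApart i c q.1 q.2) ≤ 5 * c / α := by
  classical
  -- The cluster is the neighbourhood of a random tuple `x` in the link of `u`. Vertices far apart
  -- seldom see the same `x`.
  let L : W → (Fin k → W) → Prop := fun p x => H.Adj (Function.update x i p)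
  let f₁ : (Fin k → W) → ℝ := fun x => freq fun p => L p x ∧ H.FarApart i c p u
  let f₂ : (Fin k → W) → ℝ := fun x =>
    freq fun q : W × W => L q.1 x ∧ L q.2 x ∧ H.FarApart i c q.1 q.2
  have hf₁ : ∀ x, 0 ≤ f₁ x := fun _ => freq_nonneg _
  have hf₂ : ∀ x, 0 ≤ f₂ x := fun _ => freq_nonneg _
  have h₁ : 𝔼 x, ind (L u x) * f₁ x ≤ c := by
    calc 𝔼 x, ind (L u x) * f₁ x
        = 𝔼 p, ind (H.FarApart i c p u) * freq (fun x => L p x ∧ L u x) := by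
          simp only [f₁, freq, mul_expect]
          rw [expect_comm]
          refine expect_congr rfl fun p _ => expect_congr rfl fun x _ => ?_
          simp only [ind_and]; ring
      _ ≤ 𝔼 _p : W, c := by
          refine expect_le_expect fun p _ => ?_
          by_cases hp : H.FarApart i c p u
          · rw [ind_of hp, one_mul]; exact hp.le
          · rw [ind_of_not hp, zero_mul]; exact hc.le
      _ = c := expect_const univ_nonempty _
  have h₂ : 𝔼 x, ind (L u x) * f₂ x ≤ c := by
    calc 𝔼 x, ind (L u x) * f₂ x ≤ 𝔼 x, f₂ x := expect_le_expect fun x _ => by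
          nlinarith [ind_le_one (L u x), hf₂ x]
      _ = 𝔼 q : W × W, ind (H.FarApart i c q.1 q.2) * freq (fun x => L q.1 x ∧ L q.2 x) := by
          simp only [f₂, freq, mul_expect]
          rw [expect_comm]
          refine expect_congr rfl fun p _ => expect_congr rfl fun x _ => ?_
          simp only [ind_and]; ring
      _ ≤ 𝔼 _q : W × W, c := by
          refine expect_le_expect fun q _ => ?_
          by_cases hp : H.FarApart i c q.1 q.2
          · rw [ind_of hp, one_mul]; exact hp.le
          · rw [ind_of_not hp, zero_mul]; exact hc.le
      _ = c := expect_const univ_nonempty _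
  -- The two averages add up to at most `2c`, and the link of `u` has density at least `α / 2`; so
  -- some `x` in it gives at most `4c/α`, below the bound claimed.
  obtain ⟨x, hxu, hx⟩ : ∃ x, L u x ∧ f₁ x + f₂ x ≤ 5 * c / α := by
    by_contra! hcon
    have h₃ : 5 * c / α * freq (L u) ≤ 𝔼 x, (ind (L u x) * f₁ x + ind (L u x) * f₂ x) := by
      unfold freq
      rw [mul_expect]
      refine expect_le_expect fun x _ => ?_
      by_cases hx : L u x
      · rw [ind_of hx, mul_one, one_mul, one_mul]; exact (hcon x hx).le
      · simp [ind_of_not hx]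
    rw [expect_add_distrib] at h₃
    have h₄ : α / 2 ≤ freq (L u) := hH.le_freq_link hα.le hk hn i u
    have h₅ : 5 * c / α * (α / 2) ≤ 5 * c / α * freq (L u) := by gcongr
    have h₆ : 5 * c / α * (α / 2) = 5 * c / 2 := by field_simp
    linarith
  have hn0 : (0 : ℝ) < Fintype.card W := by exact_mod_cast Fintype.card_pos
  refine ⟨univ.filter fun p => L p x, ?_, ?_, ?_⟩
  · rw [← le_div_iff₀ hn0, ← freq_eq_card]
    refine hH.le_freq i x fun a ha b hb hab => Adj.injective hxu ?_
    rwa [Function.update_of_ne (by simpa using ha), Function.update_of_ne (by simpa using hb)]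
  · simp only [mem_filter, mem_univ, true_and]
    linarith [hf₂ x]
  · simp only [mem_filter, mem_univ, true_and]
    linarith [hf₁ x]

end Adjacency

/-! ### Counting homomorphisms -/

section Homomorphisms

variable {k : ℕ} {V W : Type*} [DecidableEq W]

/-- The map `φ` sends every transversal of the classes of `χ` to an edge of `H`. -/
def IsHom (H : KGraph k W) (χ : V → Fin k) (φ : V → W) : Prop :=
  ∀ x : Fin k → V, (∀ i, χ (x i) = i) → H.Adj fun i => φ (x i)

variable {F : KGraph k V} {H : KGraph k W}

lemma IsHom.exists_copy {χ : V → Fin k} (hχ : F.IsRealisation χ) {φ : V → W} (hφ : H.IsHom χ φ)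
    (hinj : Function.Injective φ) : ∃ c : Copy F H, ∀ v, c.toEmbedding v = φ v := by
  refine ⟨⟨⟨φ, hinj⟩, fun e he => ?_⟩, fun v => rfl⟩
  have h := fun i => card_eq_one.1 (hχ.2 e he i)
  choose x hx using h
  have hx' : ∀ i, x i ∈ e ∧ χ (x i) = i := fun i => by
    have : x i ∈ e.filter fun v => χ v = i := by rw [hx]; exact mem_singleton_self _
    simpa using this
  have he : e.map ⟨φ, hinj⟩ = univ.image fun i => φ (x i) := by
    ext w
    simp only [Finset.mem_map, Function.Embedding.coeFn_mk, mem_image, mem_univ, true_and]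
    constructor
    · rintro ⟨v, hv, rfl⟩
      have : v ∈ e.filter fun u => χ u = χ v := mem_filter.2 ⟨hv, rfl⟩
      rw [hx, mem_singleton] at this
      exact ⟨χ v, by rw [← this]⟩
    · rintro ⟨i, rfl⟩
      exact ⟨x i, (hx' i).1, rfl⟩
  rw [he]
  exact hφ x fun i => (hx' i).2

lemma tiled_image_of_isHom [Fintype V] {Q : Type*} [Fintype Q] [DecidableEq Q] (f : Q × V → W)
    (hf : Function.Injective f) (χ : Q → V → Fin k) (hχ : ∀ q, F.IsRealisation (χ q))
    (hhom : ∀ q, H.IsHom (χ q) fun v => f (q, v)) : Tiled F H (univ.image f) := by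
  have himg : univ.image f = univ.biUnion fun q => univ.image fun v => f (q, v) := by
    ext w
    simp [Prod.exists]
  rw [himg]
  refine Tiled.biUnion _ _ (fun q _ => ?_) ?_
  · obtain ⟨c, hc⟩ := (hhom q).exists_copy (hχ q) fun v v' h => (Prod.ext_iff.1 (hf h)).2
    have : (univ.image fun v => f (q, v)) = univ.map c.toEmbedding := by
      ext w; simp [hc]
    rw [this]
    exact c.tiled
  · intro q _ q' _ hne
    rw [Function.onFun, disjoint_left]
    intro w hw hw'
    obtain ⟨v, -, rfl⟩ := mem_image.1 hw
    obtain ⟨v', -, h⟩ := mem_image.1 hw'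
    exact hne (Prod.ext_iff.1 (hf h)).1.symm

lemma IsDense.le_freq [Fintype W] [Nonempty W] {p μ : ℝ} (hH : H.IsDense p μ) (X : Fin k → Finset W) {δ : ℝ}
    (hp : 0 ≤ p) (hδ : 0 ≤ δ) (hX : ∀ i, δ * Fintype.card W ≤ (X i).card) :
    p * δ ^ k - μ ≤ freq fun x : Fin k → W => H.Adj x ∧ ∀ i, x i ∈ X i := by
  classical
  have hn0 : (0 : ℝ) < Fintype.card W := by exact_mod_cast Fintype.card_pos
  rw [freq_eq_card, Fintype.card_fun, Fintype.card_fin, Nat.cast_pow, le_div_iff₀ (by positivity)]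
  have h₁ : (univ.filter fun x : Fin k → W => H.Adj x ∧ ∀ i, x i ∈ X i).card = H.edgeTuples X := by
    unfold edgeTuples
    congr 1
    ext x
    simp only [mem_filter, mem_univ, true_and, Fintype.mem_piFinset]
    exact and_comm
  rw [h₁]
  refine le_trans ?_ (hH X)
  have h₂ : (δ * Fintype.card W) ^ k ≤ ∏ i, ((X i).card : ℝ) := by
    calc (δ * (Fintype.card W : ℝ)) ^ k = ∏ _i : Fin k, (δ * (Fintype.card W : ℝ)) := by simp
      _ ≤ _ := prod_le_prod (fun _ _ => by positivity) fun i _ => hX i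
  rw [mul_pow] at h₂
  rw [sub_mul]
  nlinarith

/-- Blow up each coordinate by `V` and send `v` to the copy `v` of its class: all transversals
become edges. -/
lemma pow_freq_le_freq_isHom [Fintype V] [DecidableEq V] [Fintype W] [Nonempty W] (χ : V → Fin k) (X : Fin k → Finset W) :
    (freq fun x : Fin k → W => H.Adj x ∧ ∀ i, x i ∈ X i) ^ (Fintype.card V ^ k) ≤
      freq fun φ : V → W => H.IsHom χ φ ∧ ∀ v, φ v ∈ X (χ v) := by
  refine (pow_freq_le_freq_blowup (T := V) _).trans (freq_le_of_comp (fun v => (χ v, v))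
    (fun v v' h => (Prod.ext_iff.1 h).2) fun φ hφ => ⟨fun x hx => ?_, fun v => ?_⟩)
  · simpa only [Function.comp_apply, hx] using (hφ x).1
  · exact (hφ fun _ => v).2 (χ v)

/-- The extension to all vertices of a map that is not defined at `r`. -/
def extendAt [DecidableEq V] (r : V) (ψ : {v // v ≠ r} → W) (w : W) (v : V) : W :=
  if h : v = r then w else ψ ⟨v, h⟩

/-- In a blow-up of the three edges, transversals through `r` use the edge with `u` or `v`, and
those that avoid `r` use `x` itself. -/
lemma pow_freq_le_freq_extendAt [Fintype V] [DecidableEq V] [Fintype W] [Nonempty W] (χ : V → Fin k) (r : V) (u v : W) :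
    (freq fun x : Fin k → W => H.Adj x ∧ H.Adj (Function.update x (χ r) u) ∧
      H.Adj (Function.update x (χ r) v)) ^ (Fintype.card V ^ k) ≤
      freq fun ψ : {v // v ≠ r} → W =>
        H.IsHom χ (extendAt r ψ u) ∧ H.IsHom χ (extendAt r ψ v) := by
  refine (pow_freq_le_freq_blowup (T := V) _).trans
    (freq_le_of_comp (fun v : {v // v ≠ r} => (χ v.1, v.1))
    (fun v v' h => Subtype.ext (Prod.ext_iff.1 h).2) fun φ hφ => ?_)
  have key : ∀ w, (∀ s : Fin k → V, H.Adj (Function.update (fun i => φ (i, s i)) (χ r) w)) →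
      H.IsHom χ (extendAt r (φ ∘ fun v : {v // v ≠ r} => (χ v.1, v.1)) w) := by
    intro w hw x hx
    by_cases hr : x (χ r) = r
    · convert hw x using 1
      funext i
      by_cases hi : i = χ r
      · subst hi; simp [extendAt, hr]
      · have : x i ≠ r := fun h => hi (by rw [← h, hx])
        simp [extendAt, this, Function.update_of_ne hi, hx]
    · convert (hφ x).1 using 1
      funext i
      have : x i ≠ r := fun h => hr (by rw [← h, hx, h])
      simp [extendAt, this, hx]
  exact ⟨key u fun s => (hφ s).2.1, key v fun s => (hφ s).2.2⟩

end Homomorphisms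

/-! ### Construction and counting of absorbers -/

section Configurations

variable {k : ℕ} {V W : Type*} [DecidableEq V] [DecidableEq W] {JA JB : Type*}
  {F : KGraph k V} {H : KGraph k W}

/-- The vertex that takes the place of the vertex `p` of the second family of copies. -/
def partner (e : JB × V ≃ (JA × V) ⊕ V) (s : V → W) (θ : (JA ⊕ JB) × V → W) (p : JB × V) : W :=
  Sum.elim (fun q : JA × V => θ (Sum.inl q.1, q.2)) s (e p)

/-- The positions of the copies that tile an absorber. -/
def innerTiles (r : V) :
    (JA ⊕ (JB × V)) × V → ((JA ⊕ JB) × V) ⊕ ((JB × V) × {v // v ≠ r})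
  | (Sum.inl j, v) => Sum.inl (Sum.inl j, v)
  | (Sum.inr p, v) => if h : v = r then Sum.inl (Sum.inr p.1, p.2) else Sum.inr (p, ⟨v, h⟩)

/-- The positions of the copies that tile an absorber together with the absorbed vertices. -/
def outerTiles (r : V) (e : JB × V ≃ (JA × V) ⊕ V) :
    (JB ⊕ (JB × V)) × V → (((JA ⊕ JB) × V) ⊕ ((JB × V) × {v // v ≠ r})) ⊕ V
  | (Sum.inl j, v) => Sum.inl (Sum.inl (Sum.inr j, v))
  | (Sum.inr p, v) =>
    if h : v = r then Sum.map (fun q : JA × V => Sum.inl (Sum.inl q.1, q.2)) id (e p)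
    else Sum.inl (Sum.inr (p, ⟨v, h⟩))

lemma innerTiles_bijective (r : V) :
    Function.Bijective (innerTiles (JA := JA) (JB := JB) r) := by
  constructor
  · rintro ⟨j | p, v⟩ ⟨j' | p', v'⟩ h <;> simp only [innerTiles] at h <;>
      (try split_ifs at h) <;> simp_all [Prod.ext_iff]
  · rintro (⟨j | j, v⟩ | ⟨p, v, hv⟩)
    · exact ⟨(Sum.inl j, v), rfl⟩
    · exact ⟨(Sum.inr (j, v), r), by simp [innerTiles]⟩
    · exact ⟨(Sum.inr p, v), by simp [innerTiles, hv]⟩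

lemma outerTiles_bijective (r : V) (e : JB × V ≃ (JA × V) ⊕ V) :
    Function.Bijective (outerTiles r e) := by
  have hmap : Function.Injective (Sum.map (fun q : JA × V =>
      (Sum.inl (Sum.inl q.1, q.2) : ((JA ⊕ JB) × V) ⊕ ((JB × V) × {v // v ≠ r}))) (id : V → V)) :=
    Sum.map_injective.2 ⟨fun q q' h => by simp_all [Prod.ext_iff], Function.injective_id⟩
  constructor
  · rintro ⟨j | p, v⟩ ⟨j' | p', v'⟩ h <;> simp only [outerTiles] at h
    · simp_all
    · split_ifs at h with h₁
      · rcases hq : e p' with q | q <;> simp [hq] at h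
      · simp at h
    · split_ifs at h with h₁
      · rcases hq : e p with q | q <;> simp [hq] at h
      · simp at h
    · split_ifs at h with h₁ h₂ h₂
      · rw [h₁, h₂, e.injective (hmap h)]
      · rcases hq : e p with q | q <;> simp [hq] at h
      · rcases hq : e p' with q | q <;> simp [hq] at h
      · simp_all
  · rintro ((⟨j | j, v⟩ | ⟨p, v, hv⟩) | v)
    · exact ⟨(Sum.inr (e.symm (Sum.inl (j, v))), r), by simp [outerTiles]⟩
    · exact ⟨(Sum.inl j, v), rfl⟩
    · exact ⟨(Sum.inr p, v), by simp [outerTiles, hv]⟩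
    · exact ⟨(Sum.inr (e.symm (Sum.inr v)), r), by simp [outerTiles]⟩

lemma image_comp_of_bijective {α β : Type*} [Fintype α] [Fintype β] {f : α → β}
    (hf : Function.Bijective f) (g : β → W) : univ.image (fun x => g (f x)) = univ.image g := by
  ext w
  simp only [mem_image, mem_univ, true_and]
  exact ⟨fun ⟨x, h⟩ => ⟨f x, h⟩, fun ⟨y, h⟩ => by obtain ⟨x, rfl⟩ := hf.2 y; exact ⟨x, h⟩⟩

variable [Fintype V] [Fintype JA] [Fintype JB] [DecidableEq JA] [DecidableEq JB]

/-- Alone, the copies in `JA` are tiles and the gadgets complete the vertices of `JB`. With `s`, the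
copies in `JB` are tiles and the gadgets complete the partners, which by `e` run through the
vertices of `JA` and of `s` once each. -/
lemma absorbs_of_isHom {χ : JA ⊕ JB → V → Fin k} (hχ : ∀ j, F.IsRealisation (χ j))
    {χ₀ : V → Fin k} (hχ₀ : F.IsRealisation χ₀) (r : V) (e : JB × V ≃ (JA × V) ⊕ V)
    {s : V → W} {θ : (JA ⊕ JB) × V → W} {G : (JB × V) × {v // v ≠ r} → W}
    (hθ : ∀ j, H.IsHom (χ j) fun v => θ (j, v))
    (hG : ∀ p, H.IsHom χ₀ (extendAt r (fun v => G (p, v)) (θ (Sum.inr p.1, p.2))) ∧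
      H.IsHom χ₀ (extendAt r (fun v => G (p, v)) (partner e s θ p)))
    (hinj : Function.Injective (Sum.elim (Sum.elim θ G) s)) :
    Absorbs F H s (Sum.elim θ G) := by
  refine ⟨fun i v h => ?_, ?_, ?_⟩
  · have := @hinj (Sum.inl i) (Sum.inr v) h
    simp at this
  · rw [← image_comp_of_bijective (innerTiles_bijective (JA := JA) (JB := JB) r)]
    refine tiled_image_of_isHom _ ?_ (Sum.elim (fun j => χ (Sum.inl j)) fun _ => χ₀) ?_ ?_
    · exact (hinj.comp Sum.inl_injective).comp (innerTiles_bijective r).1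
    · rintro (j | p)
      exacts [hχ _, hχ₀]
    · rintro (j | p)
      · exact hθ (Sum.inl j)
      · change H.IsHom χ₀ fun v => Sum.elim θ G (innerTiles r (Sum.inr p, v))
        convert (hG p).1 using 1
        funext v
        by_cases hv : v = r <;> simp [innerTiles, extendAt, hv]
  · have hun : univ.image (Sum.elim θ G) ∪ univ.image s =
        univ.image (Sum.elim (Sum.elim θ G) s) := by
      ext w; simp
    rw [hun, ← image_comp_of_bijective (outerTiles_bijective r e)]
    refine tiled_image_of_isHom _ ?_ (Sum.elim (fun j => χ (Sum.inr j)) fun _ => χ₀) ?_ ?_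
    · exact hinj.comp (outerTiles_bijective r e).1
    · rintro (j | p)
      exacts [hχ _, hχ₀]
    · rintro (j | p)
      · exact hθ (Sum.inr j)
      · change H.IsHom χ₀ fun v => Sum.elim (Sum.elim θ G) s (outerTiles r e (Sum.inr p, v))
        convert (hG p).2 using 1
        funext v
        by_cases hv : v = r
        · simp only [outerTiles, extendAt, hv, dif_pos, partner]
          rcases e p with q | q <;> simp
        · simp [outerTiles, extendAt, hv]

lemma freq_forall_fibre {I X Y : Type*} [Fintype I] [DecidableEq I] [Fintype X] [DecidableEq X]
    [Fintype Y] (P : I → (X → Y) → Prop) :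
    freq (fun φ : I × X → Y => ∀ i, P i fun x => φ (i, x)) = ∏ i, freq (P i) := by
  rw [← freq_forall P, ← freq_equiv (Equiv.curry I X Y)]
  rfl

variable [Fintype W]

/-- The tuples of the right shape that absorb a given `s` have positive density. -/
lemma le_freq_absorbs [Nonempty W] (A : JA → LabelledRealisation F)
    (B : JB → LabelledRealisation F) {χ₀ : V → Fin k} (hχ₀ : F.IsRealisation χ₀) (r : V)
    (e : JB × V ≃ (JA × V) ⊕ V)
    (he : ∀ p, Sum.elim (fun q : JA × V => (A q.1).1.2 ((A q.1).1.1 q.2)) id (e p) =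
      (B p.1).1.2 ((B p.1).1.1 p.2))
    (Far : W → W → Prop) (U : W → Finset W) {η ρ κ : ℝ} (hρ : 0 < ρ) (hκ : 0 < κ)
    (hU₁ : ∀ u, freq (fun p => p ∈ U u ∧ Far p u) ≤ η)
    (hU₂ : ∀ u, freq (fun q : W × W => q.1 ∈ U u ∧ q.2 ∈ U u ∧ Far q.1 q.2) ≤ η)
    (hhom : ∀ (R : LabelledRealisation F) (s : V → W), ρ ≤ freq fun φ : V → W =>
      H.IsHom R.1.1 φ ∧ ∀ v, φ v ∈ U (s (R.1.2 (R.1.1 v))))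
    (hgadget : ∀ u v, ¬Far u v → κ ≤ freq fun ψ : {v // v ≠ r} → W =>
      H.IsHom χ₀ (extendAt r ψ u) ∧ H.IsHom χ₀ (extendAt r ψ v))
    (hη : (Fintype.card (JB × V) : ℝ) * η ≤ ρ ^ Fintype.card (JA ⊕ JB) / 2)
    (hn : (Fintype.card ((((JA ⊕ JB) × V) ⊕ ((JB × V) × {v // v ≠ r})) ⊕ V) : ℝ) ^ 2 /
      Fintype.card W ≤ ρ ^ Fintype.card (JA ⊕ JB) * κ ^ Fintype.card (JB × V) / 4)
    (s : V → W) (hs : Function.Injective s) :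
    ρ ^ Fintype.card (JA ⊕ JB) * κ ^ Fintype.card (JB × V) / 4 ≤
      freq fun τ : ((JA ⊕ JB) × V) ⊕ ((JB × V) × {v // v ≠ r}) → W => Absorbs F H s τ := by
  classical
  set ι := ((JA ⊕ JB) × V) ⊕ ((JB × V) × {v // v ≠ r}) with hι
  let R : JA ⊕ JB → LabelledRealisation F := Sum.elim A B
  let lab : (JA ⊕ JB) × V → V := fun q => (R q.1).1.2 ((R q.1).1.1 q.2)
  let homs : ((JA ⊕ JB) × V → W) → Prop := fun θ =>
    ∀ j, H.IsHom (R j).1.1 (fun v => θ (j, v)) ∧ ∀ v, θ (j, v) ∈ U (s (lab (j, v)))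
  let far : JB × V → ((JA ⊕ JB) × V → W) → Prop := fun p θ =>
    Far (θ (Sum.inr p.1, p.2)) (partner e s θ p)
  have hhoms : ρ ^ Fintype.card (JA ⊕ JB) ≤ freq homs := by
    have h := freq_forall_fibre (I := JA ⊕ JB) (X := V) (Y := W) fun j φ =>
      H.IsHom (R j).1.1 φ ∧ ∀ v, φ v ∈ U (s (lab (j, v)))
    change freq homs = _ at h
    rw [h, ← card_univ, ← prod_const]
    exact prod_le_prod (fun _ _ => hρ.le) fun j _ => hhom (R j) s
  -- By `he` a vertex and its partner carry the same label. They thus lie in the same cluster, or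
  -- the partner is the vertex of `s` that defines the cluster; the far pairs are rare in both
  -- cases.
  have hfar : freq (fun θ => homs θ ∧ ∃ p, far p θ) ≤ Fintype.card (JB × V) * η := by
    calc freq (fun θ => homs θ ∧ ∃ p, far p θ)
        ≤ freq (fun θ => ∃ p, homs θ ∧ far p θ) := freq_mono fun θ ⟨h, p, hp⟩ => ⟨p, h, hp⟩
      _ ≤ ∑ p, freq (fun θ => homs θ ∧ far p θ) := freq_exists_le _
      _ ≤ ∑ _p : JB × V, η := by
          refine sum_le_sum fun p _ => ?_
          have hp := he p
          rcases hq : e p with q | v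
          · rw [hq, Sum.elim_inl] at hp
            have hne : ((Sum.inr p.1, p.2) : (JA ⊕ JB) × V) ≠ (Sum.inl q.1, q.2) := by simp
            refine le_trans (freq_mono fun θ hθ => ?_)
              ((freq_eval_pair hne fun x y => x ∈ U (s (lab (Sum.inr p.1, p.2))) ∧
                y ∈ U (s (lab (Sum.inr p.1, p.2))) ∧ Far x y).le.trans (hU₂ _))
            refine ⟨(hθ.1 _).2 _, ?_, ?_⟩
            · have : lab (Sum.inr p.1, p.2) = lab (Sum.inl q.1, q.2) := hp.symm
              rw [this]
              exact (hθ.1 _).2 _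
            · simpa only [far, partner, hq, Sum.elim_inl] using hθ.2
          · rw [hq, Sum.elim_inr] at hp
            refine le_trans (freq_mono fun θ hθ => ?_)
              ((freq_eval ((Sum.inr p.1, p.2) : (JA ⊕ JB) × V) fun x =>
                x ∈ U (s v) ∧ Far x (s v)).le.trans (hU₁ _))
            refine ⟨?_, ?_⟩
            · have : v = lab (Sum.inr p.1, p.2) := hp
              rw [this]
              exact (hθ.1 _).2 _
            · simpa only [far, partner, hq, Sum.elim_inr] using hθ.2
      _ = _ := by rw [sum_const, nsmul_eq_mul, card_univ]
  have hgood : ρ ^ Fintype.card (JA ⊕ JB) / 2 ≤ freq fun θ => homs θ ∧ ∀ p, ¬far p θ := by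
    have h := freq_le_add (P := homs) (Q := fun θ => homs θ ∧ ∃ p, far p θ)
      (R := fun θ => homs θ ∧ ∀ p, ¬far p θ) fun θ hθ => by
        by_cases hp : ∃ p, far p θ
        · exact Or.inl ⟨hθ, hp⟩
        · exact Or.inr ⟨hθ, not_exists.1 hp⟩
    linarith
  let gadgets : ((JA ⊕ JB) × V → W) → ((JB × V) × {v // v ≠ r} → W) → Prop := fun θ G =>
    ∀ p, H.IsHom χ₀ (extendAt r (fun v => G (p, v)) (θ (Sum.inr p.1, p.2))) ∧
      H.IsHom χ₀ (extendAt r (fun v => G (p, v)) (partner e s θ p))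
  -- For fixed `θ` without far pairs, the gadgets are chosen independently of each other.
  have hconf : ρ ^ Fintype.card (JA ⊕ JB) / 2 * κ ^ Fintype.card (JB × V) ≤
      freq fun τ : ι → W => homs (τ ∘ Sum.inl) ∧ gadgets (τ ∘ Sum.inl) (τ ∘ Sum.inr) := by
    have heq := freq_equiv (Equiv.sumArrowEquivProdArrow ((JA ⊕ JB) × V)
      ((JB × V) × {v // v ≠ r}) W) fun x => homs x.1 ∧ gadgets x.1 x.2
    change (freq fun τ : ι → W => homs (τ ∘ Sum.inl) ∧ gadgets (τ ∘ Sum.inl) (τ ∘ Sum.inr)) = _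
      at heq
    rw [heq, freq_prod_type]
    calc ρ ^ Fintype.card (JA ⊕ JB) / 2 * κ ^ Fintype.card (JB × V)
        ≤ (freq fun θ => homs θ ∧ ∀ p, ¬far p θ) * κ ^ Fintype.card (JB × V) := by gcongr
      _ ≤ _ := by
          unfold freq
          rw [expect_mul]
          refine expect_le_expect fun θ _ => ?_
          by_cases hθ : homs θ ∧ ∀ p, ¬far p θ
          · rw [ind_of hθ, one_mul]
            simp only [hθ.1, true_and]
            have h := freq_forall_fibre (I := JB × V) (X := {v // v ≠ r}) (Y := W) fun p ψ =>
              H.IsHom χ₀ (extendAt r ψ (θ (Sum.inr p.1, p.2))) ∧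
                H.IsHom χ₀ (extendAt r ψ (partner e s θ p))
            change freq (gadgets θ) = _ at h
            change _ ≤ freq (gadgets θ)
            rw [h, ← card_univ, ← prod_const]
            exact prod_le_prod (fun _ _ => hκ.le) fun p _ => hgadget _ _ (hθ.2 p)
          · rw [ind_of_not hθ, zero_mul]
            exact expect_nonneg fun _ _ => ind_nonneg _
  have hninj : freq (fun τ : ι → W => ¬Function.Injective (Sum.elim τ s)) ≤
      (Fintype.card (ι ⊕ V) : ℝ) ^ 2 / Fintype.card W := by
    calc freq (fun τ : ι → W => ¬Function.Injective (Sum.elim τ s))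
        ≤ freq (fun τ : ι → W => ¬Function.Injective τ) +
          freq (fun τ : ι → W => ∃ q : ι × V, τ q.1 = s q.2) := by
          refine freq_le_add fun τ hτ => ?_
          by_contra! hcon
          exact hτ (Function.Injective.sumElim hcon.1 hs fun i v h => hcon.2 (i, v) h)
      _ ≤ (Fintype.card ι : ℝ) ^ 2 / Fintype.card W +
          (Fintype.card ι * Fintype.card V : ℝ) / Fintype.card W := by
          refine add_le_add freq_not_injective_le ((freq_exists_le _).trans (le_of_eq ?_))
          simp only [freq_eval_eq, sum_const, card_univ, Fintype.card_prod, nsmul_eq_mul]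
          push_cast; ring
      _ ≤ _ := by
          have hcard : (Fintype.card (ι ⊕ V) : ℝ) = Fintype.card ι + Fintype.card V := by
            rw [Fintype.card_sum, Nat.cast_add]
          rw [← add_div, hcard]
          gcongr
          nlinarith [mul_nonneg (Nat.cast_nonneg (α := ℝ) (Fintype.card ι))
            (Nat.cast_nonneg (α := ℝ) (Fintype.card V)), sq_nonneg (Fintype.card V : ℝ)]
  have hfinal := freq_le_add
    (P := fun τ : ι → W => homs (τ ∘ Sum.inl) ∧ gadgets (τ ∘ Sum.inl) (τ ∘ Sum.inr))
    (Q := fun τ => ¬Function.Injective (Sum.elim τ s)) (R := fun τ => Absorbs F H s τ)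
    fun τ hτ => by
      by_cases hinj : Function.Injective (Sum.elim τ s)
      · right
        have hτe : Sum.elim (τ ∘ Sum.inl) (τ ∘ Sum.inr) = τ := Sum.elim_comp_inl_inr τ
        rw [← hτe]
        rw [← hτe] at hinj
        exact absorbs_of_isHom (fun j => (R j).2) hχ₀ r e (fun j => (hτ.1 j).1) hτ.2 hinj
      · exact Or.inl hinj
  linarith

end Configurations

/-! ### Almost perfect tilings and the factor -/

section Factor

variable {k : ℕ} {V W : Type*} [Fintype V] [DecidableEq W] {F : KGraph k V} {H : KGraph k W}

lemma exists_tiled_sdiff [Nonempty V] (x : ℝ)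
    (hcopy : ∀ U : Finset W, x ≤ U.card → ∃ c : Copy F H, univ.map c.toEmbedding ⊆ U)
    (U : Finset W) : ∃ L ⊆ U, (L.card : ℝ) < x ∧ Tiled F H (U \ L) := by
  induction U using Finset.strongInduction with
  | H U ih =>
    by_cases hU : x ≤ U.card
    · obtain ⟨c, hc⟩ := hcopy U hU
      have hne : (univ.map c.toEmbedding).Nonempty := univ_nonempty.map
      obtain ⟨L, hLU, hLx, hL⟩ := ih (U \ univ.map c.toEmbedding)
        (sdiff_ssubset hc hne)
      refine ⟨L, hLU.trans sdiff_subset, hLx, ?_⟩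
      have heq : U \ L = univ.map c.toEmbedding ∪ ((U \ univ.map c.toEmbedding) \ L) := by
        ext w
        simp only [Finset.mem_sdiff, Finset.mem_union]
        constructor
        · rintro ⟨h₁, h₂⟩
          by_cases hw : w ∈ univ.map c.toEmbedding
          · exact Or.inl hw
          · exact Or.inr ⟨⟨h₁, hw⟩, h₂⟩
        · rintro (h | h)
          · exact ⟨hc h, fun hwL => (Finset.mem_sdiff.1 (hLU hwL)).2 h⟩
          · exact ⟨h.1.1, h.2⟩
      rw [heq]
      exact Tiled.cons c _ (disjoint_sdiff.mono_right sdiff_subset) hL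
    · exact ⟨U, Subset.rfl, not_le.1 hU, by rw [sdiff_self]; exact Tiled.empty⟩

lemma IsDense.exists_copy [DecidableEq V] [Fintype W] [Nonempty W] {p μ δ : ℝ}
    (hH : H.IsDense p μ) {χ : V → Fin k} (hχ : F.IsRealisation χ) (hp : 0 ≤ p) (hδ : 0 ≤ δ)
    (hμ : μ ≤ p * δ ^ k / 2)
    (hn : (Fintype.card V : ℝ) ^ 2 / Fintype.card W < (p * δ ^ k / 2) ^ (Fintype.card V ^ k))
    (U : Finset W) (hU : δ * Fintype.card W ≤ U.card) :
    ∃ c : Copy F H, univ.map c.toEmbedding ⊆ U := by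
  have h₁ := hH.le_freq (fun _ => U) hp hδ fun _ => hU
  have h₂ := pow_freq_le_freq_isHom (H := H) χ fun _ => U
  have h₃ : (p * δ ^ k / 2) ^ (Fintype.card V ^ k) ≤ (freq fun x : Fin k → W => H.Adj x ∧
      ∀ i, x i ∈ (fun _ : Fin k => U) i) ^ (Fintype.card V ^ k) :=
    pow_le_pow_left₀ (by positivity) (by linarith) _
  have h₄ := freq_not_injective_le (ι := V) (X := W)
  have h₅ := freq_le_add (P := fun φ : V → W => H.IsHom χ φ ∧ ∀ v, φ v ∈ U)
    (Q := fun φ => ¬Function.Injective φ)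
    (R := fun φ => (H.IsHom χ φ ∧ ∀ v, φ v ∈ U) ∧ Function.Injective φ) fun φ hφ => by
      by_cases h : Function.Injective φ
      · exact Or.inr ⟨hφ, h⟩
      · exact Or.inl h
  obtain ⟨φ, ⟨hφ, hφU⟩, hinj⟩ := exists_of_freq_pos
    (P := fun φ : V → W => (H.IsHom χ φ ∧ ∀ v, φ v ∈ U) ∧ Function.Injective φ) (by linarith)
  obtain ⟨c, hc⟩ := hφ.exists_copy hχ hinj
  refine ⟨c, fun w hw => ?_⟩
  obtain ⟨v, -, rfl⟩ := Finset.mem_map.1 hw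
  rw [hc]
  exact hφU v

lemma codegreeAtLeast_of_minDegree [Fintype W] {α : ℝ}
    (h : α * Fintype.card W ≤ (H.minDegree (k - 1) : ℝ)) : H.CodegreeAtLeast α := by
  intro S hS
  have hle : H.minDegree (k - 1) ≤ H.deg S := Nat.sInf_le ⟨S, by omega, rfl⟩
  exact h.trans (by exact_mod_cast hle)

end Factor

/-- If the class sizes of `F` are coprime, then every set of `v(F)` vertices has a positive
proportion of absorbers. -/
lemma exists_le_freq_absorbs {k : ℕ} (hk : 2 ≤ k) {V : Type u} [Fintype V] [DecidableEq V]
    {F : KGraph k V} (hF : F.IsKPartite) (hgcd : Nat.setGcd F.classSizes = 1) {p α : ℝ}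
    (hp : 0 < p) (hα : 0 < α) :
    ∃ (ι : Type u) (_ : Fintype ι) (_ : DecidableEq ι) (β : ℝ) (n₀ : ℕ), 0 < β ∧
      ∀ (W : Type u) [Fintype W] [DecidableEq W] (H : KGraph k W) (μ : ℝ),
        n₀ ≤ Fintype.card W → μ ≤ p * α ^ k / 2 → H.IsDense p μ → H.CodegreeAtLeast α →
        ∀ s : V → W, Function.Injective s → β ≤ freq fun τ : ι → W => Absorbs F H s τ := by
  obtain ⟨a, b, A, B, e, he⟩ := exists_label_equiv hF hgcd
  obtain ⟨χ₀, hχ₀⟩ := hF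
  obtain ⟨r, -⟩ := hχ₀.1 ⟨0, by omega⟩
  set t := Fintype.card V ^ k
  set ρ : ℝ := (p * α ^ k / 2) ^ t with hρ
  have hρ0 : 0 < ρ := by positivity
  set N : ℝ := (Fintype.card (Fin b × V) : ℝ) with hN
  have hN0 : 0 ≤ N := by positivity
  -- Far pairs may then spoil at most half of the placements of the copies; the `+ 1` avoids a zero
  -- denominator. The choice of `c` below makes the cluster bound `5c/α` equal to `η`.
  set η : ℝ := ρ ^ Fintype.card (Fin a ⊕ Fin b) / (2 * (N + 1)) with hη
  have hη0 : 0 < η := by positivity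
  have hcη : 5 * (α * η / 5) / α = η := by field_simp
  set c : ℝ := α * η / 5
  have hc0 : 0 < c := by positivity
  set κ : ℝ := (α * c) ^ t with hκ
  have hκ0 : 0 < κ := by positivity
  have hβ0 : 0 < ρ ^ Fintype.card (Fin a ⊕ Fin b) * κ ^ Fintype.card (Fin b × V) / 4 := by
    positivity
  have h := tendsto_natCast_atTop_atTop (R := ℝ)
  obtain ⟨n₀, hn₀⟩ := eventually_atTop.1 <| (h.eventually_ge_atTop 1).and <|
    (h.eventually_ge_atTop (4 * (k : ℝ) ^ 2)).and <| h.eventually_ge_atTop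
      ((Fintype.card ((((Fin a ⊕ Fin b) × V) ⊕ ((Fin b × V) × {v // v ≠ r})) ⊕ V) : ℝ) ^ 2 /
        (ρ ^ Fintype.card (Fin a ⊕ Fin b) * κ ^ Fintype.card (Fin b × V) / 4))
  refine ⟨((Fin a ⊕ Fin b) × V) ⊕ ((Fin b × V) × {v // v ≠ r}), inferInstance, inferInstance,
    _, n₀, hβ0, fun W _ _ H μ hW hμ hdense hcodeg => ?_⟩
  obtain ⟨hn₁, hn₂, hn₃⟩ := hn₀ _ hW
  have hn : (0 : ℝ) < Fintype.card W := by linarith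
  have hWne : Nonempty W := Fintype.card_pos_iff.1 (Nat.cast_pos.1 hn)
  choose U hU₁ hU₂ hU₃ using hcodeg.exists_cluster hα hk hn₂ (χ₀ r) hc0
  rw [hcη] at hU₂ hU₃
  refine le_freq_absorbs A B hχ₀ r e he (H.FarApart (χ₀ r) c) U hρ0 hκ0 hU₂ hU₃ ?_ ?_ ?_
    ((div_le_comm₀ hβ0 hn).1 hn₃)
  · intro R s
    refine le_trans ?_ (pow_freq_le_freq_isHom R.1.1 fun i => U (s (R.1.2 i)))
    refine pow_le_pow_left₀ (by positivity) ?_ _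
    refine le_trans ?_ (hdense.le_freq _ hp.le hα.le fun i => hU₁ _)
    linarith
  · intro u v huv
    refine le_trans ?_ (pow_freq_le_freq_extendAt χ₀ r u v)
    refine pow_le_pow_left₀ (by positivity) ?_ _
    refine le_trans ?_ (hcodeg.mul_freq_le (χ₀ r) u v)
    exact mul_le_mul_of_nonneg_left (not_lt.1 huv) hα.le
  · rw [hη, ← hN, ← mul_div_assoc, div_le_div_iff₀ (by positivity) (by norm_num)]
    nlinarith [pow_pos hρ0 (Fintype.card (Fin a ⊕ Fin b))]

lemma inFACTOR_of_setGcd_eq_one {k : ℕ} (hk : 2 ≤ k) {V : Type u} [Fintype V] [DecidableEq V]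
    {F : KGraph k V} (hF : F.IsKPartite) (hgcd : Nat.setGcd F.classSizes = 1) :
    F.InFACTOR (k - 1) := by
  intro p α hp _ hα _
  obtain ⟨ι, _, _, β, n₁, hβ0, habs⟩ := exists_le_freq_absorbs hk hF hgcd hp hα
  obtain ⟨χ₀, hχ₀⟩ := hF
  have hVne : Nonempty V := ⟨(hχ₀.1 ⟨0, by omega⟩).choose⟩
  set t := Fintype.card V ^ k
  -- `γn` is the largest number of tuples that the hypothesis `hMn` of `exists_absorbing_set`
  -- permits.
  set γ : ℝ := β / (32 * ((Fintype.card ι : ℝ) + 1) ^ 2) with hγ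
  have hγ0 : 0 < γ := by positivity
  -- Since `M ≥ γn/2`, fewer than `εn` leftover vertices are within the capacity `βM/8` of the
  -- absorbing set.
  set ε : ℝ := β / 16 * γ with hε
  have hε0 : 0 < ε := by positivity
  -- One density error has to serve both clusters of `αn` vertices and leftover sets of `εn`
  -- vertices.
  set δ : ℝ := min α ε with hδ
  have hδ0 : 0 < δ := lt_min hα hε0
  have h := tendsto_natCast_atTop_atTop (R := ℝ)
  obtain ⟨n₀, hn₀⟩ := eventually_atTop.1 <|
    (eventually_pow_mul_exp_neg_lt (Fintype.card V) (C := 1) (c := β / 4 * (γ / 2)) (ε := 3 / 4)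
      (by positivity) (by norm_num)).and <|
    (h.eventually_ge_atTop 1).and <| (h.eventually_ge_atTop (2 / γ)).and <|
    (h.eventually_gt_atTop ((Fintype.card V : ℝ) ^ 2 / (p * ε ^ k / 2) ^ t)).and <|
    eventually_ge_atTop n₁
  refine ⟨n₀, p * δ ^ k / 2, by positivity, fun W _ _ H hW hdense hdeg hdvd => ?_⟩
  obtain ⟨hn₁, hn₂, hn₃, hn₄, hn₅⟩ := hn₀ _ hW
  rw [show k - (k - 1) = 1 by omega, pow_one] at hdeg
  have hδα : p * δ ^ k ≤ p * α ^ k := by gcongr; exact min_le_left _ _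
  have hδε : p * δ ^ k ≤ p * ε ^ k := by gcongr; exact min_le_right _ _
  replace habs := habs W H _ hn₅ (by linarith) hdense (codegreeAtLeast_of_minDegree hdeg)
  have hn0 : (0 : ℝ) < Fintype.card W := by linarith
  have hWne : Nonempty W := Fintype.card_pos_iff.1 (Nat.cast_pos.1 hn0)
  set n : ℝ := (Fintype.card W : ℝ) with hn
  set M := ⌊γ * n⌋₊ with hM
  have hγn : 2 ≤ γ * n := by rwa [div_le_iff₀' hγ0] at hn₃
  have hM₁ : (M : ℝ) ≤ γ * n := Nat.floor_le (by positivity)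
  have hM₂ : γ / 2 * n ≤ M := by
    have := (Nat.lt_floor_add_one (γ * n)).le
    linarith
  have hM₀ : 0 < M := Nat.floor_pos.2 (by linarith)
  obtain ⟨S, -, hS⟩ := exists_absorbing_set M hM₀ habs (by
      refine lt_of_le_of_lt ?_ hn₁
      rw [one_mul, ← hn, mul_assoc (β / 4)]
      gcongr) (by
      calc (M : ℝ) * (32 * ((Fintype.card ι : ℝ) + 1) ^ 2)
          ≤ γ * n * (32 * ((Fintype.card ι : ℝ) + 1) ^ 2) := by gcongr
        _ = β * n := by rw [hγ]; field_simp)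
  have hcopy := fun U => IsDense.exists_copy (δ := ε) hdense hχ₀ hp.le hε0.le (by linarith)
    ((div_lt_comm₀ (by positivity) hn0).1 hn₄) U
  obtain ⟨L, hLS, hLcard, hL⟩ := exists_tiled_sdiff _ hcopy (univ \ S)
  have hSL : Disjoint S L := disjoint_sdiff.mono_right hLS
  -- Absorbing nothing shows that `S` is tiled; so `v(F)` divides the size of `S`, and hence that of
  -- the leftover `L`.
  have hSt : Tiled F H S := by
    simpa using hS 0 ∅ (disjoint_empty_right _) (by simp) (by simp; positivity)
  have hrest : Disjoint (S ∪ L) ((univ \ S) \ L) := by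
    rw [sdiff_sdiff_left]; exact disjoint_sdiff
  have hcover : (S ∪ L) ∪ ((univ \ S) \ L) = univ := by
    rw [sdiff_sdiff_left]; exact union_sdiff_of_subset (subset_univ _)
  have hLdvd : Fintype.card V ∣ L.card := by
    have hsum : Fintype.card W = S.card + ((univ \ S) \ L).card + L.card := by
      have hc := congrArg card hcover
      rw [card_union_of_disjoint hrest, card_union_of_disjoint hSL, card_univ] at hc
      omega
    rw [hsum] at hdvd
    exact (Nat.dvd_add_right (dvd_add hSt.card_dvd hL.card_dvd)).1 hdvd
  obtain ⟨m, hm⟩ := hLdvd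
  have hmL : (m : ℝ) ≤ L.card := by
    rw [hm]
    exact_mod_cast Nat.le_mul_of_pos_left m Fintype.card_pos
  have hSLt := hS m L hSL hm (by
    have : ε * n ≤ β / 8 * M := by
      calc ε * n = β / 8 * (γ / 2 * n) := by rw [hε]; ring
        _ ≤ _ := by gcongr
    linarith)
  have hall := hSLt.union hL hrest
  rw [hcover] at hall
  exact hall.hasFactor

end KGraph

theorem theorem1p11 {k : ℕ} (hk : 3 ≤ k) {V : Type*} [Fintype V] [DecidableEq V]
    (F : KGraph k V) (hF : F.IsKPartite) :
    (Nat.setGcd F.classSizes = 1 → F.InFACTOR (k - 1)) ∧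
    (F.IsCompleteKPartite → (F.InFACTOR (k - 1) ↔ Nat.setGcd F.classSizes = 1)) :=
  ⟨KGraph.inFACTOR_of_setGcd_eq_one (by omega) hF, fun hc =>
    ⟨KGraph.setGcd_eq_one_of_inFACTOR hk hc, KGraph.inFACTOR_of_setGcd_eq_one (by omega) hF⟩⟩
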